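/- A degree function on a ring $B$ with values in $\mathbb Z\cup\{-\infty\}$ is a map $\deg$ such that $\deg x=-\infty$ iff $x=0$, $\deg(xy)=\deg x+\deg y$ and $\deg(x+y)\le\max(\deg x,\deg y)$ for all $x,y \in B$. Its associated graded ring is $\mathrm{Gr}(B)=\bigoplus_{i\in\mathbb Z}\{x\in B:\deg x\le i\}/\{x\in B:\deg x<i\}$. The function $\deg$ is determined by a grading $B=\bigoplus_{i\in\mathbb Z}R_i$ if, for every nonzero $x=\sum_i x_i$ with $x_i\in R_i$, $\deg x$ is the greatest $i$ with $x_i\neq0$. For a derivation $D:B\to B$, $\deg(D)$ is the greatest element of $\{\deg(Dx)-\deg x : x\in B\setminus\{0\}\}\subseteq\mathbb Z\cup\{-\infty\}$; it is defined if such an element exists. Proposition. Let $k_0$ be an uncountable field of characteristic zero, $k_1$ a function field over $k_0$ (that is, a finitely generated field extension of transcendence degree at least $1$) and $k_2$ the algebraic closure of $k_1$. Consider the polynomial rings $B_0\subset B_1\subset B_2$, where $B_i=k_i[X,Y]$. Then there exist degree functions $\deg_0:B_0\to\mathbb N\cup\{-\infty\}$, $\deg_1:B_1\to\mathbb N\cup\{-\infty\}$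 and $\deg_2:B_2\to\mathbb Z\cup\{-\infty\}$ satisfying the following conditions: (a) if $i\le j$ then $\deg_i$ is the restriction of $\deg_j$; (b) for each $i=0,1,2$, $\deg_i(\lambda)=0$ for all $\lambda\in k_i\setminus\{0\}$ (so that $\mathrm{Gr}(B_i)$ is a $k_i$-algebra); (c) $\deg_0$ is determined by the grading $B_0=\bigoplus_{i\in\mathbb N}R_i$ of $B_0$ defined by $k_0\subseteq R_0$, $X\in R_2$ and $Y\in R_3$ but, for each $i=1,2$, $\deg_i$ is not determined by any grading of $B_i$; (d) $\mathrm{Gr}(B_i)$ is finitely generated as a $k_i$-algebra if $i\in\{0,2\}$, but not if $i=1$; (e) $\deg_i(D_i)$ is defined if $i=0$ but not if $i\in\{1,2\}$, where $D_i=\partial/\partial Y:B_i\to B_i$. -/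

import Mathlib

/-- A degree function `B → G ∪ {-∞}` on a commutative ring `B`, where `G` is a totally ordered
abelian group; `-∞` is the bottom element `⊥` of `WithBot G`. -/
structure DegreeFunction (B : Type*) [CommRing B] (G : Type*) [AddCommGroup G] [LinearOrder G]
    [IsOrderedAddMonoid G] where
  toFun : B → WithBot G
  eq_bot_iff' : ∀ x : B, toFun x = ⊥ ↔ x = 0
  map_mul' : ∀ x y : B, toFun (x * y) = toFun x + toFun y
  map_add_le' : ∀ x y : B, toFun (x + y) ≤ max (toFun x) (toFun y)

namespace DegreeFunction

variable {B : Type*} [CommRing B] {G : Type*} [AddCommGroup G] [LinearOrder G]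
  [IsOrderedAddMonoid G]

instance : CoeFun (DegreeFunction B G) (fun _ => B → WithBot G) := ⟨DegreeFunction.toFun⟩

theorem map_zero (d : DegreeFunction B G) : d 0 = ⊥ := (d.eq_bot_iff' 0).2 rfl

theorem map_one_le (d : DegreeFunction B G) : d 1 ≤ ((0 : G) : WithBot G) := by
  have h := d.map_mul' 1 1
  rw [mul_one] at h
  cases h1 : d 1 with
  | bot => exact bot_le
  | coe g =>
    rw [h1, ← WithBot.coe_add, WithBot.coe_inj] at h
    rw [left_eq_add.1 h]

theorem map_neg_one_le (d : DegreeFunction B G) : d (-1) ≤ ((0 : G) : WithBot G) := by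
  have h := d.map_mul' (-1) (-1)
  rw [neg_one_mul, neg_neg] at h
  have h1 := d.map_one_le
  rw [h] at h1
  cases h2 : d (-1) with
  | bot => exact bot_le
  | coe g =>
    rw [h2, ← WithBot.coe_add, WithBot.coe_le_coe] at h1
    rw [WithBot.coe_le_coe]
    by_contra hg
    exact absurd h1 (not_le.2 (add_pos (not_le.1 hg) (not_le.1 hg)))

theorem map_neg_le (d : DegreeFunction B G) (x : B) : d (-x) ≤ d x := by
  have h := d.map_mul' (-1) x
  rw [neg_one_mul] at h
  rw [h]
  calc d (-1) + d x ≤ ((0 : G) : WithBot G) + d x := add_le_add_left d.map_neg_one_le _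
    _ = d x := by rw [WithBot.coe_zero, zero_add]

/-! ### The associated graded ring -/

/-- `B_i = {x ∈ B | deg x ≤ i}`. -/
def filtLE (d : DegreeFunction B G) (i : G) : AddSubgroup B where
  carrier := {x | d x ≤ (i : WithBot G)}
  zero_mem' := by simp [d.map_zero]
  add_mem' {x y} hx hy := (d.map_add_le' x y).trans (max_le hx hy)
  neg_mem' {x} hx := (d.map_neg_le x).trans hx

/-- `B_{i⁻} = {x ∈ B | deg x < i}`, as a subgroup of `B_i`. -/
def filtLT (d : DegreeFunction B G) (i : G) : AddSubgroup (d.filtLE i) where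
  carrier := {x | d (x : B) < (i : WithBot G)}
  zero_mem' := by
    change d ((0 : d.filtLE i) : B) < _
    rw [AddSubgroup.coe_zero, d.map_zero]
    exact WithBot.bot_lt_coe i
  add_mem' {x y} hx hy := (d.map_add_le' (x : B) y).trans_lt (max_lt hx hy)
  neg_mem' {x} hx := (d.map_neg_le (x : B)).trans_lt hx

/-- The homogeneous component `B_[i] = B_i / B_{i⁻}`. -/
abbrev GrPiece (d : DegreeFunction B G) (i : G) : Type _ := d.filtLE i ⧸ d.filtLT i

/-- The class of `x` in `B_[i]`, for `x ∈ B` with `deg x ≤ i`. -/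
def grMk (d : DegreeFunction B G) (i : G) (x : B) (hx : d x ≤ (i : WithBot G)) : d.GrPiece i :=
  QuotientAddGroup.mk (s := d.filtLT i) (⟨x, hx⟩ : d.filtLE i)

theorem grMk_eq (d : DegreeFunction B G) {i : G} {x y : B} (hx : d x ≤ (i : WithBot G))
    (hy : d y ≤ (i : WithBot G)) (h : d (x - y) < (i : WithBot G)) :
    d.grMk i x hx = d.grMk i y hy := by
  refine (QuotientAddGroup.eq).2 ?_
  change d (-x + y) < _
  have h' := d.map_neg_le (x - y)
  have e : -(x - y) = -x + y := by ring
  rw [e] at h'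
  exact h'.trans_lt h

theorem grMk_surj (d : DegreeFunction B G) {i : G} (a : d.GrPiece i) :
    ∃ (x : B) (hx : d x ≤ (i : WithBot G)), a = d.grMk i x hx := by
  obtain ⟨⟨x, hx⟩, rfl⟩ := QuotientAddGroup.mk_surjective a
  exact ⟨x, hx, rfl⟩

theorem sub_lt_of_rel (d : DegreeFunction B G) {i : G} {a b : d.filtLE i}
    (h : QuotientAddGroup.leftRel (d.filtLT i) a b) : d ((b : B) - a) < (i : WithBot G) := by
  have h' : d (-(a : B) + b) < (i : WithBot G) := QuotientAddGroup.leftRel_apply.1 h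
  rwa [neg_add_eq_sub] at h'

theorem mul_le (d : DegreeFunction B G) {i j : G} {x y : B} (hx : d x ≤ (i : WithBot G))
    (hy : d y ≤ (j : WithBot G)) : d (x * y) ≤ ((i + j : G) : WithBot G) := by
  rw [d.map_mul', WithBot.coe_add]
  exact add_le_add hx hy

theorem mul_lt_left (d : DegreeFunction B G) {i j : G} {x y : B} (hx : d x < (i : WithBot G))
    (hy : d y ≤ (j : WithBot G)) : d (x * y) < ((i + j : G) : WithBot G) := by
  rw [d.map_mul']
  cases h1 : d x with
  | bot => simp
  | coe a =>
    cases h2 : d y with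
    | bot => simp
    | coe b =>
      rw [h1, WithBot.coe_lt_coe] at hx
      rw [h2, WithBot.coe_le_coe] at hy
      rw [← WithBot.coe_add, WithBot.coe_lt_coe]
      exact add_lt_add_of_lt_of_le hx hy

theorem mul_sub_mul_lt (d : DegreeFunction B G) {i j : G} {x x' y y' : B}
    (hx : d (x' - x) < (i : WithBot G)) (hy : d (y' - y) < (j : WithBot G))
    (hx' : d x' ≤ (i : WithBot G)) (hy' : d y ≤ (j : WithBot G)) :
    d (x' * y' - x * y) < ((i + j : G) : WithBot G) := by
  have e : x' * y' - x * y = (x' - x) * y + (y' - y) * x' := by ring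
  rw [e]
  refine (d.map_add_le' _ _).trans_lt (max_lt (d.mul_lt_left hx hy') ?_)
  rw [add_comm i j]
  exact d.mul_lt_left hy hx'

/-- The multiplication `B_[i] × B_[j] → B_[i+j]` induced by the multiplication of `B`. -/
def grMul (d : DegreeFunction B G) {i j : G} : d.GrPiece i → d.GrPiece j → d.GrPiece (i + j) :=
  Quotient.map₂ (fun x y => ⟨(x : B) * y, d.mul_le x.2 y.2⟩) (by
    intro a a' ha b b' hb
    refine QuotientAddGroup.leftRel_apply.2 ?_
    change d (-((a : B) * b) + (a' : B) * b') < _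
    rw [neg_add_eq_sub]
    exact d.mul_sub_mul_lt (d.sub_lt_of_rel ha) (d.sub_lt_of_rel hb) a'.2 b.2)

theorem grMul_mk (d : DegreeFunction B G) {i j : G} {x y : B} (hx : d x ≤ (i : WithBot G))
    (hy : d y ≤ (j : WithBot G)) :
    d.grMul (d.grMk i x hx) (d.grMk j y hy) = d.grMk (i + j) (x * y) (d.mul_le hx hy) := rfl

theorem grMk_add (d : DegreeFunction B G) {i : G} {x y : B} (hx : d x ≤ (i : WithBot G))
    (hy : d y ≤ (i : WithBot G)) :
    d.grMk i x hx + d.grMk i y hy =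
      d.grMk i (x + y) ((d.map_add_le' x y).trans (max_le hx hy)) := rfl

theorem grMk_zero (d : DegreeFunction B G) (i : G) (h : d 0 ≤ (i : WithBot G)) :
    d.grMk i 0 h = 0 := rfl

theorem grMk_congr (d : DegreeFunction B G) {i : G} {x y : B} (h : x = y)
    (hx : d x ≤ (i : WithBot G)) (hy : d y ≤ (i : WithBot G)) :
    d.grMk i x hx = d.grMk i y hy := by
  subst h; rfl

theorem grMk_sigma (d : DegreeFunction B G) {i j : G} {x y : B} (hij : i = j) (hxy : x = y)
    (hx : d x ≤ (i : WithBot G)) (hy : d y ≤ (j : WithBot G)) :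
    (⟨i, d.grMk i x hx⟩ : GradedMonoid d.GrPiece) = ⟨j, d.grMk j y hy⟩ := by
  subst hij; subst hxy; rfl

theorem natCast_le (d : DegreeFunction B G) (n : ℕ) : d (n : B) ≤ ((0 : G) : WithBot G) := by
  induction n with
  | zero => simp [d.map_zero]
  | succ n ih =>
    rw [Nat.cast_succ]
    exact (d.map_add_le' _ _).trans (max_le ih d.map_one_le)

theorem intCast_le (d : DegreeFunction B G) (n : ℤ) : d (n : B) ≤ ((0 : G) : WithBot G) := by
  cases n with
  | ofNat n => simpa using d.natCast_le n
  | negSucc n =>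
    rw [Int.cast_negSucc]
    exact (d.map_neg_le _).trans (d.natCast_le _)

instance (d : DegreeFunction B G) : GradedMonoid.GMul d.GrPiece where
  mul := d.grMul

instance (d : DegreeFunction B G) : GradedMonoid.GOne d.GrPiece where
  one := d.grMk 0 1 d.map_one_le

noncomputable instance grGCommRing (d : DegreeFunction B G) : DirectSum.GCommRing d.GrPiece where
  mul := d.grMul
  one := d.grMk 0 1 d.map_one_le
  mul_zero {i j} a := by
    obtain ⟨x, hx, rfl⟩ := d.grMk_surj a
    rw [← d.grMk_zero j (by simp [d.map_zero]), ← d.grMk_zero (i + j) (by simp [d.map_zero])]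
    exact (d.grMul_mk _ _).trans (d.grMk_congr (mul_zero x) _ _)
  zero_mul {i j} a := by
    obtain ⟨x, hx, rfl⟩ := d.grMk_surj a
    rw [← d.grMk_zero i (by simp [d.map_zero]), ← d.grMk_zero (i + j) (by simp [d.map_zero])]
    exact (d.grMul_mk _ _).trans (d.grMk_congr (zero_mul x) _ _)
  mul_add {i j} a b c := by
    obtain ⟨x, hx, rfl⟩ := d.grMk_surj a
    obtain ⟨y, hy, rfl⟩ := d.grMk_surj b
    obtain ⟨z, hz, rfl⟩ := d.grMk_surj c
    exact d.grMk_congr (mul_add x y z)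
      (d.mul_le hx ((d.map_add_le' y z).trans (max_le hy hz)))
      ((d.map_add_le' _ _).trans (max_le (d.mul_le hx hy) (d.mul_le hx hz)))
  add_mul {i j} a b c := by
    obtain ⟨x, hx, rfl⟩ := d.grMk_surj a
    obtain ⟨y, hy, rfl⟩ := d.grMk_surj b
    obtain ⟨z, hz, rfl⟩ := d.grMk_surj c
    exact d.grMk_congr (add_mul x y z)
      (d.mul_le ((d.map_add_le' x y).trans (max_le hx hy)) hz)
      ((d.map_add_le' _ _).trans (max_le (d.mul_le hx hz) (d.mul_le hy hz)))
  one_mul := by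
    rintro ⟨i, a⟩
    obtain ⟨x, hx, rfl⟩ := d.grMk_surj a
    exact d.grMk_sigma (zero_add i) (one_mul x) (d.mul_le d.map_one_le hx) hx
  mul_one := by
    rintro ⟨i, a⟩
    obtain ⟨x, hx, rfl⟩ := d.grMk_surj a
    exact d.grMk_sigma (add_zero i) (mul_one x) (d.mul_le hx d.map_one_le) hx
  mul_assoc := by
    rintro ⟨i, a⟩ ⟨j, b⟩ ⟨l, c⟩
    obtain ⟨x, hx, rfl⟩ := d.grMk_surj a
    obtain ⟨y, hy, rfl⟩ := d.grMk_surj b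
    obtain ⟨z, hz, rfl⟩ := d.grMk_surj c
    exact d.grMk_sigma (add_assoc i j l) (mul_assoc x y z) (d.mul_le (d.mul_le hx hy) hz)
      (d.mul_le hx (d.mul_le hy hz))
  mul_comm := by
    rintro ⟨i, a⟩ ⟨j, b⟩
    obtain ⟨x, hx, rfl⟩ := d.grMk_surj a
    obtain ⟨y, hy, rfl⟩ := d.grMk_surj b
    exact d.grMk_sigma (add_comm i j) (mul_comm x y) (d.mul_le hx hy) (d.mul_le hy hx)
  natCast n := d.grMk 0 (n : B) (d.natCast_le n)
  natCast_zero := d.grMk_congr Nat.cast_zero _ (by simp [d.map_zero])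
  natCast_succ n := d.grMk_congr (Nat.cast_succ n) _
    ((d.map_add_le' _ _).trans (max_le (d.natCast_le n) d.map_one_le))
  intCast n := d.grMk 0 (n : B) (d.intCast_le n)
  intCast_ofNat n := d.grMk_congr (Int.cast_natCast n) _ _
  intCast_negSucc_ofNat n := d.grMk_congr (Int.cast_negSucc n) _
    ((d.map_neg_le _).trans (d.natCast_le _))

/-- The associated graded ring `Gr(B) = ⨁ B_[i]` of `(B, deg)`. -/
abbrev Gr (d : DegreeFunction B G) : Type _ := DirectSum G d.GrPiece

noncomputable instance grCommRing (d : DegreeFunction B G) : CommRing d.Gr :=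
  DirectSum.commRing d.GrPiece

theorem const_le {k : Type*} [Field k] [Algebra k B] (d : DegreeFunction B G)
    (h : ∀ a : k, a ≠ 0 → d (algebraMap k B a) = ((0 : G) : WithBot G)) (a : k) :
    d (algebraMap k B a) ≤ ((0 : G) : WithBot G) := by
  by_cases ha : a = 0
  · subst ha; rw [RingHom.map_zero, d.map_zero]; exact bot_le
  · exact (h a ha).le

/-- If `B` is an algebra over a field `k` and `deg` vanishes on the nonzero constants, then
`Gr(B)` is a `k`-algebra: `a ∈ k` acts through its class in `B_[0]`. This is the structure map. -/
noncomputable def grConst {k : Type*} [Field k] [Algebra k B] (d : DegreeFunction B G)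
    (h : ∀ a : k, a ≠ 0 → d (algebraMap k B a) = ((0 : G) : WithBot G)) : k →+* d.Gr where
  toFun a := DirectSum.of d.GrPiece 0 (d.grMk 0 (algebraMap k B a) (d.const_le h a))
  map_zero' := by
    rw [d.grMk_congr (RingHom.map_zero _) _ (by simp [d.map_zero]), d.grMk_zero, _root_.map_zero]
  map_one' := by
    rw [d.grMk_congr (RingHom.map_one _) _ d.map_one_le]; rfl
  map_add' a b := by
    rw [← _root_.map_add, d.grMk_add]
    exact congrArg _ (d.grMk_congr (RingHom.map_add _ a b) _ _)
  map_mul' a b := by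
    rw [DirectSum.of_mul_of]
    exact DirectSum.of_eq_of_gradedMonoid_eq (d.grMk_sigma (add_zero 0).symm
      (RingHom.map_mul _ a b) _ (d.mul_le (d.const_le h a) (d.const_le h b)))

/-- `Gr(B)` is affine over `k`: it is finitely generated as a `k`-algebra. -/
def GrIsAffine {k : Type*} [Field k] [Algebra k B] (d : DegreeFunction B G)
    (h : ∀ a : k, a ≠ 0 → d (algebraMap k B a) = ((0 : G) : WithBot G)) : Prop :=
  (d.grConst h).FiniteType

/-! ### Degree functions determined by gradings, and degrees of derivations -/

open scoped Classical in
/-- `deg` is the degree function determined by the `G`-grading `𝒜` of `B`: for all `x`,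
`deg x` is the greatest index of a nonzero homogeneous component of `x` (and `-∞` if `x = 0`). -/
def IsDeterminedBy {σ : Type*} [SetLike σ B] [AddSubmonoidClass σ B] (d : DegreeFunction B G)
    (𝒜 : G → σ) [GradedRing 𝒜] : Prop :=
  ∀ x : B, d x = (DirectSum.decompose 𝒜 x).support.max

/-- `deg` is determined by some `G`-grading of the ring `B`. -/
def IsDeterminedByGrading (d : DegreeFunction B G) : Prop :=
  ∃ (𝒜 : G → AddSubgroup B) (_ : GradedRing 𝒜), d.IsDeterminedBy 𝒜

/-- The set `{deg (D x) - deg x | x ∈ B \ {0}}`; note that `deg x = g` for some `g ∈ G` holds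
exactly when `x ≠ 0`. -/
def derivationDegrees (d : DegreeFunction B G) {R : Type*} [CommSemiring R] [Algebra R B]
    (D : Derivation R B B) : Set (WithBot G) :=
  {u | ∃ (x : B) (g : G), d x = (g : WithBot G) ∧ u = d (D x) + ((-g : G) : WithBot G)}

/-- `deg D` is defined: the set `{deg (D x) - deg x | x ∈ B \ {0}}` has a greatest element. -/
def DerivationDegreeDefined (d : DegreeFunction B G) {R : Type*} [CommSemiring R] [Algebra R B]
    (D : Derivation R B B) : Prop :=
  ∃ u, IsGreatest (d.derivationDegrees D) u

end DegreeFunction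

/-- A function field `K / k`: a finitely generated field extension of transcendence degree at
least one. -/
def IsFunctionFieldOver (k K : Type*) [Field k] [Field K] [Algebra k K] : Prop :=
  (⊤ : IntermediateField k K).FG ∧ 1 ≤ Algebra.trdeg k K

/-- The `(2,3)`-grading of `k[X, Y]`, with `X` in degree `2`, `Y` in degree `3` and the constants
in degree `0`; it is an `ℕ`-grading, regarded as a `ℤ`-grading with zero components in negative
degrees. Here `X` and `Y` are the variables of index `0` and `1`. -/
noncomputable abbrev grading23 (k : Type*) [Field k] : ℤ → Submodule k (MvPolynomial (Fin 2) k) :=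
  MvPolynomial.weightedHomogeneousSubmodule k ![(2 : ℤ), 3]

noncomputable instance grading23Graded (k : Type*) [Field k] : GradedRing (grading23 k) :=
  MvPolynomial.weightedGradedAlgebra k ![(2 : ℤ), 3]

/-! All three degrees come from one substitution `X ↦ t⁻²`, `Y ↦ y₀` into Laurent series over `k₂`,
the degree being minus the order in `t`. Here `y₀` starts a sequence `y_j = a_j t⁻³ + e_j + ⋯` with
`y_j² = a_j² t⁻⁶ + y_{j+1}`, where `a_j² = b_j` lies in `k₁`, each `a_j` is transcendental over
`k₀`, and `a_j ∈ L_{j+1} \ L_j` for an increasing tower of extensions `L_j` of `k₁`. The key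
polynomials `P₀ = Y`, `P_{j+1} = P_j² - b_j X³` take the values `y_j`, so they all have degree 3,
with leading coefficients `a_j`.

Over `k₀`: since `a₀` is transcendental, the leading term of a nonzero weighted homogeneous
polynomial cannot cancel (`hasLead_of_mem_grading23`), so the degree is the `(2,3)`-degree.

Over `k₁`: every polynomial is obtained from `k₁[X]` by iterating `q P_j + r`, where `q` and `r`
have leading coefficients in `L_j`. As `a_j ∉ L_j`, nothing cancels and degrees are nonnegative
(`exists_hasLead_of_mem_keySpan`). The leading coefficients generate an infinite algebraic
extension, so `Gr` is not finitely generated (`not_grIsAffine_laurentDegree`). A grading determining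
a nonnegative degree would make `Gr` a quotient of the polynomial ring, hence finitely generated.

Over `k₂`: the `a_j` are now constants, and a combination of `P₀`, `P₁` and `1` has negative degree.
Then every integer is a degree, each graded piece is a line over `k₂`, and two classes generate `Gr`
(`grIsAffine_of_residue`). A determining grading would yield units of nonzero degree, although all
units are constants (`not_isDeterminedByGrading`).

Finally `∂P_{j+1}/∂Y = 2 P_j ∂P_j/∂Y` gives `∂P_j/∂Y` degree `3j`, so `∂/∂Y` has unbounded degree
jumps over `k₁` and `k₂`; over `k₀` it lowers the weight by exactly 3 on `Y`. -/

/-! ### Square roots and infinite towers over a function field -/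

open Polynomial in
/-- Distinct linear polynomials are not proportional up to squares. -/
theorem sq_mul_X_sub_natCast_ne {k : Type*} [Field k] [CharZero k] {n m : ℕ} (hnm : n ≠ m)
    {P Q : k[X]} (hQ : Q ≠ 0) : (X - C (n : k)) * Q ^ 2 ≠ P ^ 2 * (X - C (m : k)) := by
  classical
  intro h
  have hX : (X - C (n : k)) ≠ 0 := X_sub_C_ne_zero _
  have hXm : (X - C (m : k)) ≠ 0 := X_sub_C_ne_zero _
  have hP : P ≠ 0 := by
    rintro rfl
    exact mul_ne_zero hX (pow_ne_zero 2 hQ) (by simpa using h)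
  -- The multiplicity of the root `n` is odd on the left and even on the right.
  have h' := congrArg (rootMultiplicity (n : k)) h
  have hm : rootMultiplicity (n : k) (X - C (m : k)) = 0 := by
    rw [rootMultiplicity_X_sub_C, if_neg (by exact_mod_cast hnm)]
  rw [rootMultiplicity_mul (mul_ne_zero hX (pow_ne_zero 2 hQ)), rootMultiplicity_X_sub_C_self,
    rootMultiplicity_mul (mul_ne_zero (pow_ne_zero 2 hP) hXm), hm, sq, sq,
    rootMultiplicity_mul (mul_ne_zero hQ hQ), rootMultiplicity_mul (mul_ne_zero hP hP)] at h'
  omega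

open Polynomial in
/-- A linear polynomial is not a square of a rational function. -/
theorem X_sub_natCast_mul_sq_ne {k : Type*} [Field k] (n : ℕ)
    {P Q : k[X]} (hQ : Q ≠ 0) : (X - C (n : k)) * Q ^ 2 ≠ P ^ 2 := by
  intro h
  have h' := congrArg natDegree h
  rw [natDegree_mul (X_sub_C_ne_zero _) (pow_ne_zero 2 hQ), natDegree_X_sub_C, natDegree_pow,
    natDegree_pow] at h'
  omega

section
open Polynomial IntermediateField

variable {k K : Type*} [Field k] [Field K] [Algebra k K] {z : K}

/-- Clearing denominators in `β = P(z)/Q(z)` turns the relation into one between polynomials. The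
case `Q = 0` is division by zero, where `β = 0`. -/
theorem Transcendental.sub_natCast_ne_sq (hz : Transcendental k z) {β : K} (hβ : β ∈ k⟮z⟯)
    (n : ℕ) : z - n ≠ β ^ 2 := by
  intro h
  obtain ⟨P, Q, rfl⟩ := (mem_adjoin_simple_iff k β).1 hβ
  have hinj := transcendental_iff_injective.1 hz
  by_cases hQ : Q = 0
  · subst hQ
    simp only [_root_.map_zero, div_zero, ne_eq, OfNat.ofNat_ne_zero, not_false_eq_true,
      zero_pow] at h
    refine hz ⟨X - C (n : k), X_sub_C_ne_zero _, ?_⟩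
    simpa using h
  · have hQ' : Polynomial.aeval z Q ≠ 0 := fun h0 => hQ (hinj (by rw [h0, _root_.map_zero]))
    refine X_sub_natCast_mul_sq_ne (k := k) n (P := P) hQ (hinj ?_)
    rw [div_pow, eq_div_iff (pow_ne_zero 2 hQ')] at h
    simpa using h

theorem Transcendental.sub_natCast_ne_sq_mul [CharZero k] (hz : Transcendental k z) {β : K}
    (hβ : β ∈ k⟮z⟯) {n m : ℕ} (hnm : n ≠ m) : z - n ≠ β ^ 2 * (z - m) := by
  intro h
  obtain ⟨P, Q, rfl⟩ := (mem_adjoin_simple_iff k β).1 hβ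
  have hinj := transcendental_iff_injective.1 hz
  by_cases hQ : Q = 0
  · subst hQ
    simp only [_root_.map_zero, div_zero, ne_eq, OfNat.ofNat_ne_zero, not_false_eq_true,
      zero_pow, zero_mul] at h
    refine hz ⟨X - C (n : k), X_sub_C_ne_zero _, ?_⟩
    simpa using h
  · have hQ' : Polynomial.aeval z Q ≠ 0 := fun h0 => hQ (hinj (by rw [h0, _root_.map_zero]))
    refine sq_mul_X_sub_natCast_ne (k := k) hnm (P := P) hQ (hinj ?_)
    rw [div_pow, div_mul_eq_mul_div, eq_div_iff (pow_ne_zero 2 hQ')] at h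
    simpa using h

/-- A finite extension of `F` contains square roots of only finitely many of the elements
`z - n`, if these are pairwise independent modulo squares of `F`. -/
theorem exists_sub_natCast_not_sq {F L : Type*} [Field F] [Field L] [Algebra F L] [CharZero F]
    [FiniteDimensional F L] (z : F) (h1 : ∀ (n : ℕ) (β : F), z - n ≠ β ^ 2)
    (h2 : ∀ (n m : ℕ), n ≠ m → ∀ β : F, z - n ≠ β ^ 2 * (z - m)) :
    ∃ n : ℕ, ∀ w : L, w ^ 2 ≠ algebraMap F L (z - n) := by
  by_contra! hcon
  choose w hw using hcon
  -- A finite separable extension has finitely many intermediate fields, so two of the fields `F(w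
  -- n)` coincide.
  have : Finite (IntermediateField F L) :=
    Field.finite_intermediateField_of_exists_primitive_element F L
      (Field.exists_primitive_element F L)
  obtain ⟨n, m, hnm, hF⟩ := Finite.exists_ne_map_eq_of_infinite (fun n => F⟮w n⟯)
  have hwF : ∀ n : ℕ, w n ∉ (algebraMap F L).range := by
    rintro n ⟨β, hβ⟩
    refine h1 n β ((algebraMap F L).injective ?_)
    rw [← hw, ← hβ, _root_.map_pow]
  have hmem : w n ∈ F⟮w m⟯ := by
    have : w n ∈ F⟮w n⟯ := mem_adjoin_simple_self F (w n)
    rwa [show F⟮w n⟯ = F⟮w m⟯ from hF] at this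
  have hint : IsIntegral F (w m) := Algebra.IsIntegral.isIntegral _
  have hmem' : w n ∈ Algebra.adjoin F {w m} := by
    rw [← adjoin_simple_toSubalgebra_of_isAlgebraic hint.isAlgebraic]
    exact hmem
  obtain ⟨α, β, hαβ⟩ : ∃ α β : F, w n = algebraMap F L α + algebraMap F L β * w m := by
    generalize w n = y at hmem'
    induction hmem' using Algebra.adjoin_induction with
    | mem x hx =>
      obtain rfl := Set.mem_singleton_iff.1 hx
      exact ⟨0, 1, by simp⟩
    | algebraMap r => exact ⟨r, 0, by simp⟩
    | add x y _ _ hx hy =>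
      obtain ⟨a, b, rfl⟩ := hx
      obtain ⟨c, d, rfl⟩ := hy
      exact ⟨a + c, b + d, by rw [_root_.map_add, _root_.map_add]; ring⟩
    | mul x y _ _ hx hy =>
      obtain ⟨a, b, rfl⟩ := hx
      obtain ⟨c, d, rfl⟩ := hy
      refine ⟨a * c + b * d * (z - m), a * d + b * c, ?_⟩
      simp only [_root_.map_add, _root_.map_mul]
      rw [← hw]
      ring
  -- Squaring `w n = α + β w m` and using `w m ∉ F` forces `αβ = 0`. Since `w n ∉ F`, this means `α
  -- = 0`, and `z - n` is a square times `z - m`.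
  have hsq : algebraMap F L (z - n) =
      algebraMap F L (α ^ 2 + β ^ 2 * (z - m)) + algebraMap F L (2 * α * β) * w m := by
    rw [← hw, hαβ]
    simp only [_root_.map_add, _root_.map_mul, _root_.map_pow, map_ofNat]
    rw [← hw]
    ring
  have h0 : 2 * α * β = 0 := by
    by_contra h0
    refine hwF m ⟨(z - n - (α ^ 2 + β ^ 2 * (z - m))) / (2 * α * β), ?_⟩
    rw [_root_.map_div₀, _root_.map_sub, hsq]
    rw [add_sub_cancel_left, mul_div_cancel_left₀]
    simpa using h0
  have hα : α = 0 := by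
    rcases mul_eq_zero.1 h0 with h | h
    · simpa using h
    · exact absurd ⟨α, by rw [hαβ, h]; simp⟩ (hwF n)
  refine h2 n m hnm β ((algebraMap F L).injective ?_)
  rw [hsq, hα]
  simp

end

section
open IntermediateField

/-- The analogue of `exists_sub_natCast_not_sq` for an intermediate field over an intermediate
base. -/
theorem exists_sub_natCast_not_sq_of_tower {F k₁ k₂ : Type*} [Field F] [Field k₁] [Field k₂]
    [Algebra F k₁] [Algebra k₁ k₂] [CharZero F] [FiniteDimensional F k₁]
    (L : IntermediateField k₁ k₂) [FiniteDimensional k₁ L] (z : F)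
    (h1 : ∀ (n : ℕ) (β : F), z - n ≠ β ^ 2)
    (h2 : ∀ (n m : ℕ), n ≠ m → ∀ β : F, z - n ≠ β ^ 2 * (z - m)) :
    ∃ n : ℕ, ∀ w ∈ L, w ^ 2 ≠ algebraMap k₁ k₂ (algebraMap F k₁ (z - n)) := by
  let : Algebra F L := ((algebraMap k₁ L).comp (algebraMap F k₁)).toAlgebra
  have : IsScalarTower F k₁ L := IsScalarTower.of_algebraMap_eq' rfl
  have : FiniteDimensional F L := FiniteDimensional.trans F k₁ L
  obtain ⟨n, hn⟩ := exists_sub_natCast_not_sq (L := L) z h1 h2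
  exact ⟨n, fun w hw hsq => hn ⟨w, hw⟩ (Subtype.ext hsq)⟩

/-- In a function field `k₁` over `k₀` there is a sequence of elements which do not all become
squares in any given finite extension of `k₁`. -/
theorem IsFunctionFieldOver.exists_nonsquares {k₀ k₁ : Type*} (k₂ : Type*) [Field k₀] [Field k₁]
    [Field k₂] [CharZero k₀] [Algebra k₀ k₁] [Algebra k₁ k₂] (hk₁ : IsFunctionFieldOver k₀ k₁) :
    ∃ b : ℕ → k₁, (∀ n, Transcendental k₀ (b n)) ∧
      ∀ L : IntermediateField k₁ k₂, FiniteDimensional k₁ L →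
        ∃ n, ∀ w ∈ L, w ^ 2 ≠ algebraMap k₁ k₂ (b n) := by
  obtain ⟨ι, x, hx⟩ := exists_isTranscendenceBasis' k₀ k₁
  have hι : Nonempty ι := by
    by_contra hne
    rw [not_nonempty_iff] at hne
    have := hx.isEmpty_iff_isAlgebraic.1 hne
    have h1 := hk₁.2
    rw [trdeg_eq_zero] at h1
    simp at h1
  obtain ⟨i⟩ := hι
  -- One member `x i` of a transcendence basis is singled out; `k` is generated by the others. Then
  -- `k₁` is finite over `F = k(x i)`, and the sequence is `x i - n`.
  have hz : Transcendental (adjoin k₀ (x '' {i}ᶜ)) (x i) :=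
    transcendental_adjoin_iff.2 (hx.1.transcendental_adjoin (by simp))
  have hz₀ : Transcendental k₀ (x i) := hx.1.transcendental i
  obtain ⟨k, hk⟩ : ∃ k, k = adjoin k₀ (x '' {i}ᶜ) := ⟨_, rfl⟩
  rw [← hk] at hz
  obtain ⟨F, hF⟩ : ∃ F, F = k⟮x i⟯ := ⟨_, rfl⟩
  have hF' : ∀ y ∈ F, y ∈ k⟮x i⟯ := fun y hy => hF ▸ hy
  have hle : adjoin k₀ (Set.range x) ≤ F.restrictScalars k₀ := by
    rw [adjoin_le_iff]
    rintro _ ⟨j, rfl⟩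
    by_cases hj : j = i
    · subst hj hF
      exact mem_adjoin_simple_self k (x j)
    · exact F.algebraMap_mem ⟨x j, hk ▸ subset_adjoin _ _ ⟨j, hj, rfl⟩⟩
  have halg : Algebra.IsAlgebraic F k₁ := by
    have := hx.isAlgebraic_field
    refine ⟨fun y => ?_⟩
    exact (this.isAlgebraic y).ringHom_of_comp_eq (S := F)
      ((inclusion hle : _ →+* F.restrictScalars k₀) : adjoin k₀ (Set.range x) →+* F)
      (RingHom.id k₁) (inclusion hle).injective (RingHom.ext fun _ => rfl)
  have htower : IsScalarTower k₀ F k₁ := IsScalarTower.of_algebraMap_eq fun _ => rfl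
  have hess : Algebra.EssFiniteType F k₁ := by
    have := fg_top_iff.1 hk₁.1
    exact Algebra.EssFiniteType.of_comp k₀ F k₁
  have hfin : FiniteDimensional F k₁ := Algebra.finite_of_essFiniteType_of_isAlgebraic
  have : CharZero F := charZero_of_injective_algebraMap (algebraMap k₀ F).injective
  have : CharZero k := charZero_of_injective_algebraMap (algebraMap k₀ k).injective
  have hmem : x i ∈ F := hF ▸ mem_adjoin_simple_self k (x i)
  refine ⟨fun n => x i - n, fun n h => hz₀ ?_, fun L hL => ?_⟩
  · have := h.add (isAlgebraic_natCast n)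
    rwa [sub_add_cancel] at this
  · obtain ⟨n, hn⟩ := exists_sub_natCast_not_sq_of_tower L (F := F) ⟨x i, hmem⟩
      (fun n β hβ => hz.sub_natCast_ne_sq (hF' β β.2) n
        (by simpa using congrArg (algebraMap F k₁) hβ))
      (fun n m hnm β hβ => hz.sub_natCast_ne_sq_mul (hF' β β.2) hnm
        (by simpa using congrArg (algebraMap F k₁) hβ))
    refine ⟨n, fun w hw hsq => hn w hw ?_⟩
    rw [hsq]
    simp

/-- There is a sequence of square roots of elements of a function field generating a strictly
increasing tower of finite extensions. -/
theorem IsFunctionFieldOver.exists_tower {k₀ k₁ : Type*} (k₂ : Type*) [Field k₀] [Field k₁]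
    [Field k₂] [CharZero k₀] [Algebra k₀ k₁] [Algebra k₁ k₂] [Algebra k₀ k₂]
    [IsScalarTower k₀ k₁ k₂] [IsAlgClosure k₁ k₂] (hk₁ : IsFunctionFieldOver k₀ k₁) :
    ∃ (b : ℕ → k₁) (a : ℕ → k₂) (L : ℕ → IntermediateField k₁ k₂),
      (∀ j, a j ^ 2 = algebraMap k₁ k₂ (b j)) ∧ (∀ j, Transcendental k₀ (a j)) ∧
      Monotone L ∧ (∀ j, a j ∈ L (j + 1)) ∧ (∀ j, a j ∉ L j) := by
  classical
  obtain ⟨c, hc, hL⟩ := hk₁.exists_nonsquares k₂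
  have : IsAlgClosed k₂ := IsAlgClosure.isAlgClosed k₁
  have : Algebra.IsAlgebraic k₁ k₂ := IsAlgClosure.isAlgebraic
  -- Finitely many algebraic elements generate a finite extension, which misses a square root of
  -- some `c n`; adjoining it to `S` gives the next floor of the tower.
  have key : ∀ S : Finset k₂, ∃ (w : k₂) (n : ℕ), w ^ 2 = algebraMap k₁ k₂ (c n) ∧
      w ∉ adjoin k₁ (S : Set k₂) := by
    intro S
    obtain ⟨n, hn⟩ := hL (adjoin k₁ (S : Set k₂))
      (finiteDimensional_adjoin fun x _ => Algebra.IsIntegral.isIntegral x)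
    obtain ⟨w, hw⟩ := IsAlgClosed.exists_pow_nat_eq (algebraMap k₁ k₂ (c n)) two_pos
    exact ⟨w, n, hw, fun hmem => hn w hmem hw⟩
  choose w n hw hwn using key
  obtain ⟨S, hS⟩ : ∃ S : ℕ → Finset k₂, ∀ j, S (j + 1) = insert (w (S j)) (S j) :=
    ⟨fun j => Nat.rec ∅ (fun _ T => insert (w T) T) j, fun _ => rfl⟩
  refine ⟨fun j => c (n (S j)), fun j => w (S j), fun j => adjoin k₁ (S j : Set k₂),
    fun j => hw _, fun j h => hc (n (S j)) ?_, monotone_nat_of_le_succ fun j => ?_,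
    fun j => ?_, fun j => hwn _⟩
  · have h2 := h.pow 2
    rw [hw] at h2
    exact (isAlgebraic_algebraMap_iff (algebraMap k₁ k₂).injective).1 h2
  · refine adjoin.mono _ _ _ ?_
    rw [hS]
    simp
  · refine subset_adjoin _ _ ?_
    rw [hS]
    simp

end

/-! ### Degrees and leading coefficients of Laurent series -/

section
open LaurentSeries

variable {K : Type*} [Field K]

/-- The Laurent series `s` in `t` has degree at most `n` in `t⁻¹`, and the coefficient of
`(t⁻¹) ^ n` in `s` is `c`. -/
def HasLead (s : K⸨X⸩) (n : ℤ) (c : K) : Prop :=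
  ∃ p : PowerSeries K, s = HahnSeries.single (-n) 1 * (p : K⸨X⸩) ∧ PowerSeries.constantCoeff p = c

namespace HasLead

variable {s t : K⸨X⸩} {n m : ℤ} {c d : K}

theorem mul (hs : HasLead s n c) (ht : HasLead t m d) : HasLead (s * t) (n + m) (c * d) := by
  obtain ⟨p, rfl, rfl⟩ := hs
  obtain ⟨q, rfl, rfl⟩ := ht
  refine ⟨p * q, ?_, by simp⟩
  rw [map_mul, neg_add, ← one_mul (1 : K), ← HahnSeries.single_mul_single, one_mul]
  ring

theorem add (hs : HasLead s n c) (ht : HasLead t n d) : HasLead (s + t) n (c + d) := by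
  obtain ⟨p, rfl, rfl⟩ := hs
  obtain ⟨q, rfl, rfl⟩ := ht
  exact ⟨p + q, by rw [map_add]; ring, by simp⟩

theorem neg (hs : HasLead s n c) : HasLead (-s) n (-c) := by
  obtain ⟨p, rfl, rfl⟩ := hs
  exact ⟨-p, by rw [map_neg]; ring, by simp⟩

theorem sub (hs : HasLead s n c) (ht : HasLead t n d) : HasLead (s - t) n (c - d) := by
  rw [sub_eq_add_neg, sub_eq_add_neg]
  exact hs.add ht.neg

theorem zero (n : ℤ) : HasLead (0 : K⸨X⸩) n 0 := ⟨0, by simp, by simp⟩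

theorem const (c : K) : HasLead (HahnSeries.C c : K⸨X⸩) 0 c :=
  ⟨PowerSeries.C c, by simp, by simp⟩

theorem one : HasLead (1 : K⸨X⸩) 0 1 := ⟨1, by simp, by simp⟩

theorem single (n : ℤ) (c : K) : HasLead (HahnSeries.single (-n) c) n c :=
  ⟨PowerSeries.C c, by
    rw [HahnSeries.ofPowerSeries_C, HahnSeries.C_apply, HahnSeries.single_mul_single]; simp, by simp⟩

theorem pow (hs : HasLead s n c) (k : ℕ) : HasLead (s ^ k) (k * n) (c ^ k) := by
  induction k with
  | zero => simpa using one
  | succ k ih =>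
    rw [pow_succ, pow_succ]
    convert! ih.mul hs using 1
    push_cast
    ring

/-- The coefficient in `HasLead` may vanish, so `HasLead s m 0` expresses degree less than `m`. -/
theorem mono (hs : HasLead s n c) (h : n < m) : HasLead s m 0 := by
  obtain ⟨p, rfl, rfl⟩ := hs
  obtain ⟨k, hk⟩ := Int.eq_ofNat_of_zero_le (by omega : 0 ≤ m - n)
  have hk0 : k ≠ 0 := by omega
  refine ⟨PowerSeries.X ^ k * p, ?_, by simp [hk0]⟩
  rw [map_mul, HahnSeries.ofPowerSeries_X_pow, ← mul_assoc, HahnSeries.single_mul_single, one_mul]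
  congr 3
  omega

theorem coeff_eq (hs : HasLead s n c) : s.coeff (-n) = c := by
  obtain ⟨p, rfl, rfl⟩ := hs
  have := HahnSeries.coeff_single_mul_add (r := (1 : K)) (x := (p : K⸨X⸩)) (a := 0) (b := -n)
  rw [zero_add] at this
  rw [this, one_mul]
  exact (LaurentSeries.coeff_coe_powerSeries p 0).trans (by simp)

theorem ne_zero (hs : HasLead s n c) (hc : c ≠ 0) : s ≠ 0 := by
  rintro rfl
  exact hc (by simpa using hs.coeff_eq.symm)

theorem unique (hs : HasLead s n c) (hs' : HasLead s n d) : c = d :=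
  hs.coeff_eq.symm.trans hs'.coeff_eq

theorem neg_le_order (hs : HasLead s n c) (h0 : s ≠ 0) : -n ≤ s.order := by
  obtain ⟨p, rfl, rfl⟩ := hs
  rw [HahnSeries.order_mul (by simp) (right_ne_zero_of_mul h0),
    HahnSeries.order_single one_ne_zero]
  have : 0 ≤ (p : K⸨X⸩).order := by
    by_contra! hlt
    refine HahnSeries.coeff_order_eq_zero.not.2 (right_ne_zero_of_mul h0) ?_
    generalize (p : K⸨X⸩).order = o at hlt
    rw [HahnSeries.ofPowerSeries_apply, HahnSeries.embDomain_of_notMem_range]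
    rintro ⟨k, hk⟩
    simp only [Nat.castOrderEmbedding_apply] at hk
    omega
  omega

theorem order_eq (hs : HasLead s n c) (hc : c ≠ 0) : s.order = -n :=
  le_antisymm (HahnSeries.order_le_of_coeff_ne_zero (hs.coeff_eq ▸ hc))
    (hs.neg_le_order (hs.ne_zero hc))

theorem of_order (_h : s ≠ 0) : HasLead s (-s.order) (s.coeff s.order) :=
  ⟨s.powerSeriesPart, by rw [neg_neg, single_order_mul_powerSeriesPart], by
    rw [← PowerSeries.coeff_zero_eq_constantCoeff_apply, powerSeriesPart_coeff]
    simp⟩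

theorem exists_of_ne_zero (h : s ≠ 0) : ∃ (n : ℤ) (c : K), c ≠ 0 ∧ HasLead s n c :=
  ⟨_, _, HahnSeries.coeff_order_eq_zero.not.2 h, of_order h⟩

theorem of_neg_le_order (h : s = 0 ∨ -n ≤ s.order) : HasLead s n (s.coeff (-n)) := by
  by_cases h0 : s = 0
  · subst h0; simpa using zero n
  · have h := h.resolve_left h0
    rcases h.eq_or_lt with h | h
    · rw [h]
      convert! of_order h0 using 1
      omega
    · have h1 := (of_order h0).mono (m := n) (by omega)
      rw [h1.coeff_eq]
      exact h1

end HasLead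

end

/-! ### The degree function of an embedding into Laurent series -/

section
open LaurentSeries

variable {K : Type*} [Field K] {B : Type*} [CommRing B]

open scoped Classical in
/-- The degree in `t⁻¹`, pulled back along an embedding of `B` into the ring of Laurent series
in `t`. -/
noncomputable def laurentDegree (φ : B →+* K⸨X⸩) (hφ : Function.Injective φ) :
    DegreeFunction B ℤ where
  toFun f := if φ f = 0 then ⊥ else ((-(φ f).order : ℤ) : WithBot ℤ)
  eq_bot_iff' x := by
    rw [map_eq_zero_iff φ hφ]
    split_ifs with h <;> simp [h]
  map_mul' x y := by
    rw [map_mul]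
    by_cases hx : φ x = 0
    · simp [hx]
    by_cases hy : φ y = 0
    · simp [hy]
    rw [if_neg hx, if_neg hy, if_neg (mul_ne_zero hx hy), HahnSeries.order_mul hx hy,
      ← WithBot.coe_add, neg_add]
  map_add_le' x y := by
    rw [map_add]
    by_cases hxy : φ x + φ y = 0
    · simp [hxy]
    by_cases hx : φ x = 0
    · simp [hx]
    by_cases hy : φ y = 0
    · simp [hy]
    rw [if_neg hx, if_neg hy, if_neg hxy, le_max_iff, WithBot.coe_le_coe, WithBot.coe_le_coe]
    have := HahnSeries.min_order_le_order_add hxy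
    rw [min_le_iff] at this
    omega

variable {φ : B →+* K⸨X⸩} {hφ : Function.Injective φ} {f : B} {n : ℤ} {c : K}

open scoped Classical in
theorem laurentDegree_eq_coe_iff :
    laurentDegree φ hφ f = n ↔ ∃ c, c ≠ 0 ∧ HasLead (φ f) n c := by
  change (if φ f = 0 then ⊥ else ((-(φ f).order : ℤ) : WithBot ℤ)) = n ↔ _
  split_ifs with h
  · simp only [WithBot.bot_ne_coe, false_iff, not_exists, not_and]
    exact fun c hc hl => hl.ne_zero hc h
  · rw [WithBot.coe_inj]
    constructor
    · rintro rfl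
      exact ⟨_, HahnSeries.coeff_order_eq_zero.not.2 h, HasLead.of_order h⟩
    · rintro ⟨c, hc, hl⟩
      rw [hl.order_eq hc, neg_neg]

theorem HasLead.laurentDegree_eq (h : HasLead (φ f) n c) (hc : c ≠ 0) :
    laurentDegree φ hφ f = n := laurentDegree_eq_coe_iff.2 ⟨c, hc, h⟩

open scoped Classical in
theorem laurentDegree_le_coe_iff :
    laurentDegree φ hφ f ≤ n ↔ HasLead (φ f) n ((φ f).coeff (-n)) := by
  change (if φ f = 0 then ⊥ else ((-(φ f).order : ℤ) : WithBot ℤ)) ≤ n ↔ _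
  split_ifs with h
  · simpa using HasLead.of_neg_le_order (Or.inl h)
  · rw [WithBot.coe_le_coe]
    constructor
    · intro hn
      exact HasLead.of_neg_le_order (Or.inr (by omega))
    · intro hl
      have := hl.neg_le_order h
      omega

theorem HasLead.laurentDegree_le (h : HasLead (φ f) n c) : laurentDegree φ hφ f ≤ n := by
  rw [laurentDegree_le_coe_iff, h.coeff_eq]
  exact h

theorem laurentDegree_lt_coe_iff :
    laurentDegree φ hφ f < n ↔ HasLead (φ f) n 0 := by
  constructor
  · intro h
    have h1 := laurentDegree_le_coe_iff.1 h.le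
    by_cases h0 : (φ f).coeff (-n) = 0
    · rwa [h0] at h1
    · exact absurd (h1.laurentDegree_eq h0) h.ne
  · intro h
    refine lt_of_le_of_ne h.laurentDegree_le fun h1 => ?_
    obtain ⟨c, hc, hl⟩ := laurentDegree_eq_coe_iff.1 h1
    exact hc (hl.unique h)

open scoped Classical in
theorem laurentDegree_congr {A : Type*} [CommRing A] {ψ : A →+* K⸨X⸩}
    {hψ : Function.Injective ψ} {x : A} (h : ψ x = φ f) :
    laurentDegree ψ hψ x = laurentDegree φ hφ f := by
  change (if ψ x = 0 then ⊥ else ((-(ψ x).order : ℤ) : WithBot ℤ)) =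
    if φ f = 0 then ⊥ else ((-(φ f).order : ℤ) : WithBot ℤ)
  rw [h]

end

/-! ### A system of quadratic equations in power series -/

section
open PowerSeries

variable {K : Type*} [Field K]

/-- The coefficients of the solution of `u j ^ 2 = 1 + d j * X ^ 3 * u (j + 1)`, where the
constant terms are equal to `1`. -/
noncomputable def nestedSqrtCoeff (d : ℕ → K) (n : ℕ) (j : ℕ) : K :=
  if n = 0 then 1 else
    ((if 3 ≤ n then d j * nestedSqrtCoeff d (n - 3) (j + 1) else 0) -
      ∑ i : Fin (n - 1), nestedSqrtCoeff d (i + 1) j * nestedSqrtCoeff d (n - 1 - i) j) / 2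
termination_by n
decreasing_by all_goals omega

/-- The coefficient of `X ^ n` in `u j ^ 2` is twice the `n`-th coefficient of `u j` plus products
of earlier ones, and the right side involves only index `n - 3` of `u (j + 1)`. Recursion on `n`,
for all `j` at once, therefore solves the infinite system. -/
theorem exists_nestedSqrt [CharZero K] (d : ℕ → K) :
    ∃ u : ℕ → PowerSeries K, (∀ j, constantCoeff (u j) = 1) ∧
      ∀ j, u j ^ 2 = 1 + C (d j) * X ^ 3 * u (j + 1) := by
  refine ⟨fun j => PowerSeries.mk fun n => nestedSqrtCoeff d n j, fun j => ?_, fun j => ?_⟩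
  · rw [← coeff_zero_eq_constantCoeff_apply, coeff_mk, nestedSqrtCoeff]
    simp
  · have h0 : ∀ j, nestedSqrtCoeff d 0 j = 1 := fun j => by rw [nestedSqrtCoeff]; simp
    ext n
    rw [sq, coeff_mul, map_add, mul_assoc, coeff_C_mul, coeff_X_pow_mul', coeff_one]
    simp only [coeff_mk]
    rw [Finset.Nat.sum_antidiagonal_eq_sum_range_succ
      (fun a b => nestedSqrtCoeff d a j * nestedSqrtCoeff d b j)]
    cases n with
    | zero => simp [h0]
    | succ n =>
      rw [Finset.sum_range_succ, Finset.sum_range_succ', Nat.sub_self, h0, Nat.sub_zero]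
      have h := nestedSqrtCoeff.eq_def d (n + 1) j
      rw [if_neg n.succ_ne_zero, eq_div_iff two_ne_zero] at h
      replace h : nestedSqrtCoeff d (n + 1) j * 2 =
          (if 3 ≤ n + 1 then d j * nestedSqrtCoeff d (n + 1 - 3) (j + 1) else 0) -
          ∑ i : Fin n, nestedSqrtCoeff d (i + 1) j * nestedSqrtCoeff d (n - i) j := h
      rw [Finset.sum_range]
      have hs : ∑ i : Fin n, nestedSqrtCoeff d (i + 1) j * nestedSqrtCoeff d (n + 1 - (i + 1)) j =
          ∑ i : Fin n, nestedSqrtCoeff d (i + 1) j * nestedSqrtCoeff d (n - i) j :=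
        Finset.sum_congr rfl fun i _ => by rw [Nat.add_sub_add_right]
      rw [hs, if_neg n.succ_ne_zero, zero_add, mul_ite, mul_zero]
      linear_combination h

end

/-! ### Nested square roots as Laurent series -/

section
open LaurentSeries

/-- In `u² - 1 = (u - 1)(u + 1)` the second factor has constant term 2 and is a unit. -/
theorem PowerSeries.X_pow_dvd_sub_one {K : Type*} [Field K] [CharZero K] {u : PowerSeries K}
    {n : ℕ} (h1 : PowerSeries.constantCoeff u = 1) (h : PowerSeries.X ^ n ∣ u ^ 2 - 1) :
    PowerSeries.X ^ n ∣ u - 1 := by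
  have hu : IsUnit (u + 1) := by
    rw [PowerSeries.isUnit_iff_constantCoeff, map_add, h1, map_one, isUnit_iff_ne_zero]
    norm_num
  rw [← hu.dvd_mul_right]
  convert h using 1
  ring

/-- A sequence of Laurent series `y j = a j * t⁻³ + ⋯`, each one being a square root of
`(a j * t⁻³) ^ 2 + y (j + 1)`. -/
theorem exists_nested_sqrt_laurent {K : Type*} [Field K] [CharZero K] (a : ℕ → K)
    (ha : ∀ j, a j ≠ 0) :
    ∃ (y : ℕ → K⸨X⸩) (e : ℕ → K),
      (∀ j, HasLead (y j - HahnSeries.single (-3) (a j)) 0 (e j)) ∧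
      ∀ j, y j ^ 2 = HahnSeries.C (a j ^ 2) * HahnSeries.single (-2) 1 ^ 3 + y (j + 1) := by
  -- With `y j = a j t⁻³ u j`, this choice of `d j` makes `(a j t⁻³)² · d j t³ u (j + 1)` equal to
  -- `y (j + 1)`. Since `t³` divides `u j - 1`, no powers `t⁻²` or `t⁻¹` occur in `y j`.
  obtain ⟨u, hu1, hu⟩ := exists_nestedSqrt fun j => a (j + 1) / a j ^ 2
  have hdvd : ∀ j, PowerSeries.X ^ 3 ∣ u j - 1 := fun j =>
    PowerSeries.X_pow_dvd_sub_one (hu1 j) ⟨PowerSeries.C (a (j + 1) / a j ^ 2) * u (j + 1), by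
      rw [hu]; ring⟩
  choose v hv using hdvd
  refine ⟨fun j => HahnSeries.single (-3) (a j) * (u j : K⸨X⸩),
    fun j => a j * PowerSeries.constantCoeff (v j), fun j => ?_, fun j => ?_⟩
  · refine ⟨PowerSeries.C (a j) * v j, ?_, by simp⟩
    have h1 : u j = 1 + PowerSeries.X ^ 3 * v j := by rw [← hv]; ring
    have h2 : HahnSeries.single (-3) (a j) * (HahnSeries.single 3 (1 : K)) = HahnSeries.C (a j) := by
      rw [HahnSeries.single_mul_single]
      simp [HahnSeries.C_apply]
    dsimp only
    rw [h1, map_add, map_one, map_mul, map_mul, HahnSeries.ofPowerSeries_C,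
      HahnSeries.ofPowerSeries_X_pow, ← h2]
    simp only [neg_zero, Nat.cast_ofNat]
    have h3 : (HahnSeries.single (0 : ℤ) (1 : K)) = 1 := rfl
    rw [h3]
    ring
  · have h2 : HahnSeries.single (-3) (a j) = HahnSeries.C (a j) * HahnSeries.single (-3) 1 := by
      rw [HahnSeries.C_apply, HahnSeries.single_mul_single]
      simp
    have h3 : HahnSeries.single (-3) (a (j + 1)) =
        HahnSeries.C (a (j + 1)) * HahnSeries.single (-3) 1 := by
      rw [HahnSeries.C_apply, HahnSeries.single_mul_single]
      simp
    have h4 : (HahnSeries.single (-2) (1 : K)) ^ 3 = HahnSeries.single (-3) 1 ^ 2 := by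
      rw [HahnSeries.single_pow, HahnSeries.single_pow]
      simp
    have h5 : HahnSeries.single (-3) (1 : K) * HahnSeries.single 3 (1 : K) = 1 := by
      rw [HahnSeries.single_mul_single]
      rw [one_mul]
      rfl
    have h6 : (HahnSeries.C (a j) : K⸨X⸩) ^ 2 * HahnSeries.C (a (j + 1) / a j ^ 2) =
        HahnSeries.C (a (j + 1)) := by
      rw [← map_pow, ← map_mul, mul_div_cancel₀ _ (pow_ne_zero 2 (ha j))]
    dsimp only
    rw [mul_pow, ← map_pow (HahnSeries.ofPowerSeries ℤ K), hu, map_add, map_one, map_mul, map_mul, HahnSeries.ofPowerSeries_C,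
      HahnSeries.ofPowerSeries_X_pow, h2, h3, h4, map_pow, ← h6]
    push_cast
    linear_combination (HahnSeries.C (a j)) ^ 2 * HahnSeries.C (a (j + 1) / a j ^ 2) *
      (u (j + 1) : K⸨X⸩) * HahnSeries.single (-3) (1 : K) * h5

end

/-! ### Key polynomials -/

section
open MvPolynomial

variable {k : Type*} [Field k]

/-- The key polynomials `Y`, `Y² - b₀ X³`, `(Y² - b₀ X³)² - b₁ X³`, … -/
noncomputable def keyPoly (b : ℕ → k) : ℕ → MvPolynomial (Fin 2) k
  | 0 => X 1
  | j + 1 => keyPoly b j ^ 2 - C (b j) * X 0 ^ 3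

/-- The polynomials of degree less than `2 ^ j` in `Y`, through their expansions in terms of
key polynomials. -/
def keySpan (b : ℕ → k) : ℕ → Set (MvPolynomial (Fin 2) k)
  | 0 => {f | f ∈ Algebra.adjoin k {(X 0 : MvPolynomial (Fin 2) k)}}
  | j + 1 => {f | ∃ q ∈ keySpan b j, ∃ r ∈ keySpan b j, f = q * keyPoly b j + r}

variable (b : ℕ → k)

theorem keyPoly_sq (j : ℕ) : keyPoly b j ^ 2 = keyPoly b (j + 1) + C (b j) * X (0 : Fin 2) ^ 3 := by
  rw [keyPoly]; ring

theorem zero_mem_keySpan (j : ℕ) : 0 ∈ keySpan b j := by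
  induction j with
  | zero => exact zero_mem (Algebra.adjoin k {(X 0 : MvPolynomial (Fin 2) k)})
  | succ j ih => exact ⟨0, ih, 0, ih, by ring⟩

theorem keySpan_le_succ {j : ℕ} {f : MvPolynomial (Fin 2) k} (hf : f ∈ keySpan b j) :
    f ∈ keySpan b (j + 1) := ⟨0, zero_mem_keySpan b j, f, hf, by ring⟩

theorem keySpan_mono : Monotone (keySpan b) :=
  monotone_nat_of_le_succ fun _ _ hf => keySpan_le_succ b hf

theorem add_mem_keySpan {j : ℕ} {f g : MvPolynomial (Fin 2) k} (hf : f ∈ keySpan b j)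
    (hg : g ∈ keySpan b j) : f + g ∈ keySpan b j := by
  induction j generalizing f g with
  | zero => exact (Algebra.adjoin k {(X 0 : MvPolynomial (Fin 2) k)}).add_mem hf hg
  | succ j ih =>
    obtain ⟨q, hq, r, hr, rfl⟩ := hf
    obtain ⟨q', hq', r', hr', rfl⟩ := hg
    exact ⟨q + q', ih hq hq', r + r', ih hr hr', by ring⟩

theorem mul_base_mem_keySpan {j : ℕ} {f g : MvPolynomial (Fin 2) k} (hf : f ∈ keySpan b j)
    (hg : g ∈ keySpan b 0) : f * g ∈ keySpan b j := by
  induction j generalizing f with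
  | zero => exact (Algebra.adjoin k {(X 0 : MvPolynomial (Fin 2) k)}).mul_mem hf hg
  | succ j ih =>
    obtain ⟨q, hq, r, hr, rfl⟩ := hf
    exact ⟨q * g, ih hq, r * g, ih hr, by ring⟩

theorem C_mem_keySpan (c : k) : C c ∈ keySpan b 0 :=
  (Algebra.adjoin k {(X 0 : MvPolynomial (Fin 2) k)}).algebraMap_mem c

theorem X_mem_keySpan : X 0 ∈ keySpan b 0 := Algebra.subset_adjoin rfl

theorem coeff_mem_keySpan (j : ℕ) : C (b j) * X 0 ^ 3 ∈ keySpan b 0 := by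
  exact (Algebra.adjoin k {(X 0 : MvPolynomial (Fin 2) k)}).mul_mem (C_mem_keySpan b _)
    ((Algebra.adjoin k {(X 0 : MvPolynomial (Fin 2) k)}).pow_mem (X_mem_keySpan b) 3)

/-- A square of `keyPoly b j` produced by the product is replaced by `keyPoly b (j + 1)` plus a
polynomial in `X` alone. -/
theorem mul_keyPoly_mem_keySpan {j : ℕ} {f : MvPolynomial (Fin 2) k}
    (hf : f ∈ keySpan b (j + 1)) : f * keyPoly b j ∈ keySpan b (j + 2) := by
  obtain ⟨q, hq, r, hr, rfl⟩ := hf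
  refine ⟨q, keySpan_le_succ b hq, r * keyPoly b j + q * (C (b j) * X 0 ^ 3),
    ⟨r, hr, _, mul_base_mem_keySpan b hq (coeff_mem_keySpan b j), rfl⟩, ?_⟩
  linear_combination q * keyPoly_sq b j

/-- Degrees in `Y` below `2 ^ j` add up to one below `2 ^ (j + 1)`. The set is not closed under
multiplication, but the increasing union is a ring containing both variables. -/
theorem mul_mem_keySpan {j : ℕ} {f g : MvPolynomial (Fin 2) k} (hf : f ∈ keySpan b j)
    (hg : g ∈ keySpan b j) : f * g ∈ keySpan b (j + 1) := by
  induction j generalizing f g with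
  | zero => exact keySpan_le_succ b (mul_base_mem_keySpan b hf hg)
  | succ j ih =>
    obtain ⟨q, hq, r, hr, rfl⟩ := hf
    obtain ⟨q', hq', r', hr', rfl⟩ := hg
    have h1 : q * q' * keyPoly b (j + 1) ∈ keySpan b (j + 2) :=
      ⟨q * q', ih hq hq', 0, zero_mem_keySpan b _, by ring⟩
    have h2 := mul_keyPoly_mem_keySpan b (add_mem_keySpan b (ih hq hr') (ih hq' hr))
    have h3 := keySpan_le_succ b (add_mem_keySpan b
      (mul_base_mem_keySpan b (ih hq hq') (coeff_mem_keySpan b j)) (ih hr hr'))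
    convert! add_mem_keySpan b (add_mem_keySpan b h1 h2) h3 using 1
    linear_combination q * q' * keyPoly_sq b j

theorem keyPoly_mem_keySpan (j : ℕ) : keyPoly b j ∈ keySpan b (j + 1) :=
  ⟨1, keySpan_mono b (Nat.zero_le j) (by simpa using C_mem_keySpan b 1), 0, zero_mem_keySpan b j,
    by ring⟩

theorem exists_mem_keySpan (f : MvPolynomial (Fin 2) k) : ∃ j, f ∈ keySpan b j := by
  induction f using MvPolynomial.induction_on with
  | C c => exact ⟨0, C_mem_keySpan b c⟩
  | add p q hp hq =>
    obtain ⟨i, hi⟩ := hp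
    obtain ⟨j, hj⟩ := hq
    exact ⟨max i j, add_mem_keySpan b (keySpan_mono b (le_max_left i j) hi)
      (keySpan_mono b (le_max_right i j) hj)⟩
  | mul_X p i hp =>
    obtain ⟨j, hj⟩ := hp
    refine ⟨max j 1 + 1, mul_mem_keySpan b (keySpan_mono b (le_max_left j 1) hj)
      (keySpan_mono b (le_max_right j 1) ?_)⟩
    fin_cases i
    · exact keySpan_le_succ b (X_mem_keySpan b)
    · exact keyPoly_mem_keySpan b 0

end

/-! ### Evaluation of polynomials at Laurent series -/

section
open LaurentSeries MvPolynomial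

variable (k : Type*) {K : Type*} [Field k] [Field K] [Algebra k K]

/-- The substitution `X ↦ t⁻²`, `Y ↦ y`. -/
noncomputable def seriesHom (y : K⸨X⸩) : MvPolynomial (Fin 2) k →+* K⸨X⸩ :=
  eval₂Hom (HahnSeries.C.comp (algebraMap k K)) ![HahnSeries.single (-2) 1, y]

variable {k} {y : K⸨X⸩}

@[simp] theorem seriesHom_C (c : k) :
    seriesHom k y (C c) = HahnSeries.C (algebraMap k K c) := by simp [seriesHom]

@[simp] theorem seriesHom_X_zero : seriesHom k y (X 0) = HahnSeries.single (-2) 1 := by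
  simp [seriesHom]

@[simp] theorem seriesHom_X_one : seriesHom k y (X 1) = y := by simp [seriesHom]

theorem hasLead_X_zero : HasLead (seriesHom k y (X 0)) 2 1 := by
  rw [seriesHom_X_zero]
  exact HasLead.single 2 1

theorem seriesHom_map {k' : Type*} [Field k'] [Algebra k' K] [Algebra k k'] [IsScalarTower k k' K]
    (f : MvPolynomial (Fin 2) k) : seriesHom k' y (map (algebraMap k k') f) = seriesHom k y f := by
  rw [seriesHom, seriesHom, coe_eval₂Hom, coe_eval₂Hom, eval₂_map, RingHom.comp_assoc,
    ← IsScalarTower.algebraMap_eq]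

/-- The powers of `x` have distinct degrees, so only the last term reaches degree `2 * n`. -/
theorem HasLead.sum_powers {x : K⸨X⸩} (hx : HasLead x 2 1) (c : ℕ → K) (n : ℕ) :
    HasLead (∑ i ∈ Finset.range (n + 1), HahnSeries.C (c i) * x ^ i) (2 * n) (c n) := by
  have h (i : ℕ) : HasLead (HahnSeries.C (c i) * x ^ i) (2 * i) (c i) := by
    convert! (HasLead.const (c i)).mul (hx.pow i) using 1
    · ring
    · simp
  induction n with
  | zero =>
    rw [zero_add, Finset.sum_range_one]
    exact h 0
  | succ n ih =>
    rw [Finset.sum_range_succ]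
    simpa using (ih.mono (m := 2 * ((n + 1 : ℕ) : ℤ)) (by push_cast; omega)).add (h (n + 1))

variable {b : ℕ → k} {ys : ℕ → K⸨X⸩} {a : ℕ → K}

theorem seriesHom_keyPoly (hab : ∀ j, a j ^ 2 = algebraMap k K (b j))
    (hys : ∀ j, ys j ^ 2 = HahnSeries.C (a j ^ 2) * HahnSeries.single (-2) 1 ^ 3 + ys (j + 1))
    (j : ℕ) : seriesHom k (ys 0) (keyPoly b j) = ys j := by
  induction j with
  | zero => simp [keyPoly]
  | succ j ih =>
    rw [keyPoly, map_sub, map_mul, map_pow, map_pow, ih, seriesHom_C, seriesHom_X_zero, ← hab, hys]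
    ring

/-- In `q * keyPoly b j + r` the leading coefficients of `q` and `r` lie in `L j` while that of the
key polynomial does not, so the two terms cannot cancel. This yields both the injectivity of the
substitution over `k` and the nonnegativity of the degree. -/
theorem exists_hasLead_of_mem_keySpan {L : ℕ → IntermediateField k K} (hL : Monotone L)
    (haL : ∀ j, a j ∈ L (j + 1)) (haL' : ∀ j, a j ∉ L j)
    (hkey : ∀ j, HasLead (seriesHom k y (keyPoly b j)) 3 (a j)) (j : ℕ)
    {f : MvPolynomial (Fin 2) k} (hf : f ∈ keySpan b j) (h0 : f ≠ 0) :
    ∃ (n : ℕ) (c : K), c ∈ L j ∧ c ≠ 0 ∧ HasLead (seriesHom k y f) n c := by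
  induction j generalizing f with
  | zero =>
    have hf' : f ∈ Algebra.adjoin k {(X 0 : MvPolynomial (Fin 2) k)} := hf
    rw [Algebra.adjoin_singleton_eq_range_aeval] at hf'
    obtain ⟨p, rfl⟩ := hf'
    have hp : p ≠ 0 := by
      rintro rfl
      exact h0 (by simp)
    refine ⟨2 * p.natDegree, algebraMap k K p.leadingCoeff, (L 0).algebraMap_mem _, by simpa, ?_⟩
    have h := HasLead.sum_powers (hasLead_X_zero (k := k) (y := y))
      (fun i => algebraMap k K (p.coeff i)) p.natDegree
    have he : seriesHom k y (Polynomial.aeval (X 0) p) =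
        ∑ i ∈ Finset.range (p.natDegree + 1),
          HahnSeries.C (algebraMap k K (p.coeff i)) * seriesHom k y (X 0) ^ i := by
      rw [Polynomial.aeval_eq_sum_range, map_sum]
      refine Finset.sum_congr rfl fun i _ => ?_
      rw [smul_eq_C_mul, map_mul, map_pow, seriesHom_C]
    change HasLead (seriesHom k y (Polynomial.aeval (X 0) p)) _ _
    rw [he]
    exact_mod_cast h
  | succ j ih =>
    obtain ⟨q, hq, r, hr, rfl⟩ := hf
    have hle : L j ≤ L (j + 1) := hL j.le_succ
    have ha0 : a j ≠ 0 := fun h => haL' j (h ▸ zero_mem _)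
    by_cases hq0 : q = 0
    · subst hq0
      rw [zero_mul, zero_add] at h0 ⊢
      obtain ⟨n, c, hc, hc0, h⟩ := ih hr h0
      exact ⟨n, c, hle hc, hc0, h⟩
    obtain ⟨n, c, hc, hc0, h⟩ := ih hq hq0
    have hqG := h.mul (hkey j)
    rw [← map_mul] at hqG
    have hca : c * a j ∈ L (j + 1) := mul_mem (hle hc) (haL j)
    have hca0 : c * a j ≠ 0 := mul_ne_zero hc0 ha0
    by_cases hr0 : r = 0
    · subst hr0
      rw [add_zero]
      exact ⟨n + 3, c * a j, hca, hca0, by exact_mod_cast hqG⟩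
    obtain ⟨m, d, hd, hd0, h'⟩ := ih hr hr0
    rw [map_add]
    rcases lt_trichotomy (n + 3) m with hlt | heq | hlt
    · refine ⟨m, d, hle hd, hd0, ?_⟩
      simpa using (hqG.mono (by exact_mod_cast hlt)).add h'
    · subst heq
      refine ⟨n + 3, c * a j + d, add_mem hca (hle hd), fun hs => haL' j ?_, ?_⟩
      · have : a j = -d / c := by rw [eq_div_iff hc0]; linear_combination hs
        rw [this]
        exact div_mem (neg_mem hd) hc
      · push_cast at h' ⊢
        exact hqG.add h'
    · refine ⟨n + 3, c * a j, hca, hca0, ?_⟩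
      have := hqG.add (h'.mono (m := (n : ℤ) + 3) (by exact_mod_cast hlt))
      rw [add_zero] at this
      exact_mod_cast this

theorem isIntegralElem_map_algebraMap (k : Type*) {k' σ : Type*} [Field k] [Field k']
    [Algebra k k'] [Algebra.IsAlgebraic k k'] (f : MvPolynomial σ k') :
    (map (σ := σ) (algebraMap k k')).IsIntegralElem f := by
  induction f using MvPolynomial.induction_on with
  | C c =>
    obtain ⟨p, hp, hpc⟩ := Algebra.IsIntegral.isIntegral (R := k) c
    refine ⟨p.map C, hp.map C, ?_⟩
    have : (map (algebraMap k k')).comp C = (C : k' →+* MvPolynomial σ k').comp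
        (algebraMap k k') := RingHom.ext fun x => map_C _ x
    rw [Polynomial.eval₂_map, this, ← Polynomial.hom_eval₂, hpc, map_zero]
  | add p q hp hq => exact hp.add _ hq
  | mul_X p i hp =>
    refine hp.mul _ ?_
    have := (map (σ := σ) (algebraMap k k')).isIntegralElem_map (x := X i)
    rwa [map_X] at this

/-- An evaluation which is injective on polynomials over `k` remains so after an algebraic
extension of scalars. -/
theorem seriesHom_injective_of_isAlgebraic {k' : Type*} [Field k'] [Algebra k' K] [Algebra k k']
    [IsScalarTower k k' K] [Algebra.IsAlgebraic k k']
    (h : Function.Injective (seriesHom k y)) : Function.Injective (seriesHom k' y) := by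
  rw [injective_iff_map_eq_zero]
  intro f hf
  by_contra h0
  let : Algebra (MvPolynomial (Fin 2) k) (MvPolynomial (Fin 2) k') :=
    (map (algebraMap k k')).toAlgebra
  have hint : IsIntegral (MvPolynomial (Fin 2) k) f := isIntegralElem_map_algebraMap k f
  -- In a domain, an ideal containing a nonzero integral element meets the base ring nontrivially:
  -- the constant term of a minimal integral equation is nonzero and lies in the ideal.
  have := Ideal.comap_ne_bot_of_integral_mem (I := RingHom.ker (seriesHom k' y)) h0 hf hint
  rw [Ne, eq_bot_iff] at this
  refine this fun g hg => h ?_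
  rw [map_zero, ← seriesHom_map (k' := k')]
  exact hg

end

/-! ### Degree functions determined by gradings -/

namespace DegreeFunction

section
open DirectSum

variable {B : Type*} [CommRing B] (d : DegreeFunction B ℤ)

theorem map_add_of_lt {x y : B} (h : d y < d x) : d (x + y) = d x := by
  refine le_antisymm ((d.map_add_le' x y).trans (max_le le_rfl h.le)) ?_
  have h1 := d.map_add_le' (x + y) (-y)
  rw [add_neg_cancel_right] at h1
  rcases le_max_iff.1 h1 with h2 | h2
  · exact h2
  · exact absurd (h2.trans (d.map_neg_le y)) (not_le.2 h)

theorem map_sum_le {ι : Type*} (s : Finset ι) (x : ι → B) {u : WithBot ℤ}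
    (h : ∀ i ∈ s, d (x i) ≤ u) : d (∑ i ∈ s, x i) ≤ u := by
  classical
  induction s using Finset.induction_on with
  | empty => simp [d.map_zero]
  | insert i s hi ih =>
    rw [Finset.sum_insert hi]
    exact (d.map_add_le' _ _).trans (max_le (h i (Finset.mem_insert_self i s))
      (ih fun j hj => h j (Finset.mem_insert_of_mem hj)))

theorem map_sum_eq_max (s : Finset ℤ) (x : ℤ → B) (h : ∀ i ∈ s, d (x i) = (i : WithBot ℤ)) :
    d (∑ i ∈ s, x i) = s.max := by
  induction s using Finset.induction_on_max with
  | empty => simp [d.map_zero]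
  | insert a s hs ih =>
    have ha : a ∉ s := fun ha => lt_irrefl a (hs a ha)
    have ih := ih fun i hi => h i (Finset.mem_insert_of_mem hi)
    have hlt : s.max < (a : WithBot ℤ) := by
      refine (Finset.sup_lt_iff (WithBot.bot_lt_coe a)).2 fun i hi => ?_
      exact WithBot.coe_lt_coe.2 (hs i hi)
    have hxa := h a (Finset.mem_insert_self a s)
    rw [Finset.sum_insert ha, Finset.max_insert, max_eq_left hlt.le,
      d.map_add_of_lt (by rw [ih, hxa]; exact hlt), hxa]

variable {σ : Type*} [SetLike σ B] [AddSubmonoidClass σ B] {d} {𝒜 : ℤ → σ} [GradedRing 𝒜]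

theorem isDeterminedBy_of_forall_mem (h : ∀ i, ∀ x ∈ 𝒜 i, x ≠ 0 → d x = (i : WithBot ℤ)) :
    d.IsDeterminedBy 𝒜 := by
  classical
  intro x
  conv_lhs => rw [← DirectSum.sum_support_decompose 𝒜 x]
  refine d.map_sum_eq_max _ _ fun i hi => ?_
  refine h i _ (SetLike.coe_mem _) ?_
  rw [DFinsupp.mem_support_iff] at hi
  simpa using hi

namespace IsDeterminedBy

variable (hd : d.IsDeterminedBy 𝒜)
include hd

theorem decompose_eq_zero {x : B} {i : ℤ} (h : d x < (i : WithBot ℤ)) : decompose 𝒜 x i = 0 := by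
  classical
  by_contra hi
  rw [hd x] at h
  exact absurd (Finset.le_max (DFinsupp.mem_support_iff.2 hi)) (not_le.2 h)

theorem decompose_ne_zero {x : B} {i : ℤ} (h : d x = (i : WithBot ℤ)) : decompose 𝒜 x i ≠ 0 := by
  classical
  rw [hd x] at h
  exact DFinsupp.mem_support_iff.1 (Finset.mem_of_max h)

theorem lt_of_decompose {x : B} {i : ℤ} (h : ∀ j, i ≤ j → decompose 𝒜 x j = 0) :
    d x < (i : WithBot ℤ) := by
  cases hx : d x with
  | bot => exact WithBot.bot_lt_coe i
  | coe n =>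
    rw [WithBot.coe_lt_coe]
    by_contra! hle
    exact hd.decompose_ne_zero hx (h n hle)

theorem le_of_mem {x : B} {i : ℤ} (h : x ∈ 𝒜 i) : d x ≤ (i : WithBot ℤ) := by
  cases hx : d x with
  | bot => exact bot_le
  | coe n =>
    rw [WithBot.coe_le_coe]
    by_contra! hlt
    refine hd.decompose_ne_zero hx (Subtype.ext ?_)
    rw [decompose_of_mem_ne 𝒜 h hlt.ne]
    rfl

theorem eq_of_mem {x : B} {i : ℤ} (h : x ∈ 𝒜 i) (h0 : x ≠ 0) : d x = (i : WithBot ℤ) := by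
  refine (hd.le_of_mem h).antisymm (not_lt.1 fun hlt => h0 ?_)
  have := hd.decompose_eq_zero hlt
  rw [← decompose_of_mem_same 𝒜 h, this]
  rfl

theorem sub_decompose_lt {x : B} {i : ℤ} (h : d x ≤ (i : WithBot ℤ)) :
    d (x - decompose 𝒜 x i) < (i : WithBot ℤ) := by
  refine hd.lt_of_decompose fun j hj => Subtype.ext ?_
  have h1 : (decompose 𝒜 x j : B) =
      decompose 𝒜 (x - decompose 𝒜 x i) j + decompose 𝒜 (decompose 𝒜 x i : B) j := by
    conv_lhs => rw [← sub_add_cancel x (decompose 𝒜 x i : B), decompose_add]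
    rfl
  rcases hj.eq_or_lt with rfl | hlt
  · rw [decompose_of_mem_same 𝒜 (SetLike.coe_mem _)] at h1
    simpa using h1
  · rw [decompose_of_mem_ne 𝒜 (SetLike.coe_mem _) hlt.ne, add_zero,
      hd.decompose_eq_zero (h.trans_lt (WithBot.coe_lt_coe.2 hlt))] at h1
    exact h1.symm

end IsDeterminedBy

/-! ### Classes in the associated graded ring and its finite generation -/

/-- The class of `x` in `Gr(B)`, as an element of degree `i`. -/
noncomputable def symbol (d : DegreeFunction B ℤ) (i : ℤ) (x : B) (hx : d x ≤ (i : WithBot ℤ)) :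
    d.Gr := DirectSum.of d.GrPiece i (d.grMk i x hx)

theorem symbol_mul {i j : ℤ} {x y : B} (hx : d x ≤ (i : WithBot ℤ)) (hy : d y ≤ (j : WithBot ℤ)) :
    d.symbol i x hx * d.symbol j y hy = d.symbol (i + j) (x * y) (d.mul_le hx hy) :=
  DirectSum.of_mul_of _ _

theorem symbol_add {i : ℤ} {x y : B} (hx : d x ≤ (i : WithBot ℤ)) (hy : d y ≤ (i : WithBot ℤ)) :
    d.symbol i x hx + d.symbol i y hy =
      d.symbol i (x + y) ((d.map_add_le' x y).trans (max_le hx hy)) := by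
  rw [symbol, symbol, ← _root_.map_add, d.grMk_add]
  rfl

theorem symbol_zero (i : ℤ) (h : d 0 ≤ (i : WithBot ℤ)) : d.symbol i 0 h = 0 := by
  rw [symbol, d.grMk_zero, _root_.map_zero]

theorem symbol_one (h : d 1 ≤ ((0 : ℤ) : WithBot ℤ)) : d.symbol 0 1 h = 1 := rfl

theorem symbol_congr {i j : ℤ} (hij : i = j) {x y : B} (hx : d x ≤ (i : WithBot ℤ))
    (hy : d y ≤ (j : WithBot ℤ)) (h : d (x - y) < (i : WithBot ℤ)) :
    d.symbol i x hx = d.symbol j y hy := by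
  subst hij
  rw [symbol, symbol, d.grMk_eq hx hy h]

theorem symbol_congr' {i j : ℤ} (hij : i = j) {x y : B} (hxy : x = y) (hx : d x ≤ (i : WithBot ℤ))
    (hy : d y ≤ (j : WithBot ℤ)) : d.symbol i x hx = d.symbol j y hy := by
  subst hij hxy
  rfl

theorem symbol_induction {p : d.Gr → Prop} (h0 : p 0)
    (hs : ∀ (i : ℤ) (x : B) (hx : d x ≤ (i : WithBot ℤ)), p (d.symbol i x hx))
    (hadd : ∀ u v, p u → p v → p (u + v)) (u : d.Gr) : p u := by
  induction u using DirectSum.induction_on with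
  | zero => exact h0
  | of i a =>
    obtain ⟨x, hx, rfl⟩ := d.grMk_surj a
    exact hs i x hx
  | add u v hu hv => exact hadd u v hu hv

theorem pow_le {i : ℤ} {x : B} (hx : d x ≤ (i : WithBot ℤ)) (n : ℕ) :
    d (x ^ n) ≤ ((n * i : ℤ) : WithBot ℤ) := by
  induction n with
  | zero => simpa using d.map_one_le
  | succ n ih =>
    rw [pow_succ]
    convert! d.mul_le ih hx using 2
    push_cast
    ring

theorem symbol_pow {i : ℤ} {x : B} (hx : d x ≤ (i : WithBot ℤ)) (n : ℕ) :
    d.symbol i x hx ^ n = d.symbol (n * i) (x ^ n) (pow_le hx n) := by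
  induction n with
  | zero =>
    rw [pow_zero, ← symbol_one d.map_one_le]
    exact symbol_congr' (by simp) (by simp) _ _
  | succ n ih =>
    rw [pow_succ, ih, symbol_mul]
    exact symbol_congr' (by push_cast; ring) (pow_succ x n).symm _ _

/-- The map from the homogeneous elements of degree `i` to their classes. -/
noncomputable def IsDeterminedBy.symbolHom (hd : d.IsDeterminedBy 𝒜) (i : ℤ) : 𝒜 i →+ d.Gr where
  toFun x := d.symbol i x (hd.le_of_mem x.2)
  map_zero' := symbol_zero i _
  map_add' x y := (symbol_add (hd.le_of_mem x.2) (hd.le_of_mem y.2)).symm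

theorem IsDeterminedBy.symbolHom_one (hd : d.IsDeterminedBy 𝒜) :
    hd.symbolHom 0 (GradedMonoid.GOne.one (A := fun i => 𝒜 i)) = 1 := rfl

theorem IsDeterminedBy.symbolHom_mul (hd : d.IsDeterminedBy 𝒜) {i j : ℤ} (x : 𝒜 i) (y : 𝒜 j) :
    hd.symbolHom (i + j) (GradedMonoid.GMul.mul (A := fun i => 𝒜 i) x y) = hd.symbolHom i x * hd.symbolHom j y :=
  (symbol_mul (hd.le_of_mem x.2) (hd.le_of_mem y.2)).symm

/-- The comparison map from a graded ring to the associated graded ring of the degree function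
determined by the grading. -/
noncomputable def IsDeterminedBy.toGr (hd : d.IsDeterminedBy 𝒜) : B →+* d.Gr :=
  (DirectSum.toSemiring (A := fun i => 𝒜 i) hd.symbolHom hd.symbolHom_one
    hd.symbolHom_mul).comp (decomposeRingEquiv 𝒜 : B →+* _)

theorem IsDeterminedBy.toGr_of_mem (hd : d.IsDeterminedBy 𝒜) {x : B} {i : ℤ} (h : x ∈ 𝒜 i) :
    hd.toGr x = d.symbol i x (hd.le_of_mem h) := by
  change (DirectSum.toSemiring (A := fun i => 𝒜 i) hd.symbolHom hd.symbolHom_one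
    hd.symbolHom_mul) (decompose 𝒜 x) = _
  rw [decompose_of_mem 𝒜 h, DirectSum.toSemiring_of]
  rfl

/-- The class of `x` in degree `i` is that of its homogeneous component of degree `i`, the
difference having smaller degree. -/
theorem IsDeterminedBy.toGr_surjective (hd : d.IsDeterminedBy 𝒜) :
    Function.Surjective hd.toGr := by
  intro u
  change u ∈ hd.toGr.range
  induction u using symbol_induction with
  | h0 => exact zero_mem _
  | hs i x hx =>
    refine ⟨decompose 𝒜 x i, ?_⟩
    rw [hd.toGr_of_mem (SetLike.coe_mem _)]
    refine (symbol_congr rfl hx _ ?_).symm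
    exact hd.sub_decompose_lt hx
  | hadd u v hu hv => exact add_mem hu hv

theorem IsDeterminedBy.grIsAffine (hd : d.IsDeterminedBy 𝒜) {k : Type*} [Field k] [Algebra k B]
    [Algebra.FiniteType k B]
    (h : ∀ a : k, a ≠ 0 → d (algebraMap k B a) = ((0 : ℤ) : WithBot ℤ))
    (hk : ∀ a : k, algebraMap k B a ∈ 𝒜 0) : d.GrIsAffine h := by
  have h1 : (algebraMap k B).FiniteType := RingHom.finiteType_algebraMap.2 inferInstance
  have h2 : d.grConst h = hd.toGr.comp (algebraMap k B) := by
    ext1 a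
    rw [RingHom.comp_apply, hd.toGr_of_mem (hk a)]
    rfl
  rw [GrIsAffine, h2]
  exact h1.comp_surjective hd.toGr_surjective

/-- If a nonnegative degree function on a finitely generated algebra is determined by a grading,
then the associated graded ring is finitely generated. -/
theorem IsDeterminedByGrading.grIsAffine (hd : d.IsDeterminedByGrading) {k : Type*} [Field k]
    [Algebra k B] [Algebra.FiniteType k B]
    (h : ∀ a : k, a ≠ 0 → d (algebraMap k B a) = ((0 : ℤ) : WithBot ℤ))
    (hnonneg : ∀ f, f ≠ 0 → ∃ n : ℕ, d f = ((n : ℤ) : WithBot ℤ)) : d.GrIsAffine h := by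
  obtain ⟨𝒜, _, hd⟩ := hd
  refine hd.grIsAffine h fun a => ?_
  -- The pieces of the grading are only additive subgroups, so constants must be shown to have
  -- degree 0 in it: a constant minus its component of degree 0 has negative degree, hence vanishes.
  have h1 := hd.sub_decompose_lt (d.const_le h a)
  have h2 : algebraMap k B a - decompose 𝒜 (algebraMap k B a) 0 = 0 := by
    by_contra h0
    obtain ⟨n, hn⟩ := hnonneg _ h0
    rw [hn, WithBot.coe_lt_coe] at h1
    omega
  rw [sub_eq_zero.1 h2]
  exact SetLike.coe_mem _

/-- The top components `u`, `v` of `f`, `g` have a product of degree 0, which `hres` inverts modulo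
negative degree. The degree 0 component of that relation is an exact equation `u * v * y₀ = 1`,
making `u` a unit of degree `i ≠ 0`. -/
theorem not_isDeterminedByGrading {f g : B} {i : ℤ} (hi : i ≠ 0) (hf : d f = (i : WithBot ℤ))
    (hg : d g = ((-i : ℤ) : WithBot ℤ))
    (hres : ∀ x, d x = ((0 : ℤ) : WithBot ℤ) → ∃ y, d (x * y - 1) < ((0 : ℤ) : WithBot ℤ))
    (hunit : ∀ x, IsUnit x → d x = ((0 : ℤ) : WithBot ℤ)) : ¬ d.IsDeterminedByGrading := by
  rintro ⟨𝒜, _, hd⟩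
  have hu0 : (decompose 𝒜 f i : B) ≠ 0 := by simpa using hd.decompose_ne_zero hf
  have hv0 : (decompose 𝒜 g (-i) : B) ≠ 0 := by simpa using hd.decompose_ne_zero hg
  have hu : (decompose 𝒜 f i : B) ∈ 𝒜 i := SetLike.coe_mem _
  have hv : (decompose 𝒜 g (-i) : B) ∈ 𝒜 (-i) := SetLike.coe_mem _
  generalize (decompose 𝒜 f i : B) = u at hu0 hu
  generalize (decompose 𝒜 g (-i) : B) = v at hv0 hv
  have hdu := hd.eq_of_mem hu hu0
  have huv : u * v ∈ 𝒜 0 := by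
    have := SetLike.mul_mem_graded hu hv
    rwa [add_neg_cancel] at this
  obtain ⟨y, hy⟩ := hres (u * v) (by
    rw [d.map_mul', hdu, hd.eq_of_mem hv hv0, ← WithBot.coe_add, add_neg_cancel])
  have h0 := congrArg (Subtype.val) (hd.decompose_eq_zero hy)
  rw [decompose_sub, DirectSum.sub_apply, AddSubgroup.coe_sub,
    coe_decompose_mul_of_left_mem_zero 𝒜 huv,
    decompose_of_mem_same 𝒜 SetLike.GradedOne.one_mem] at h0
  have h1 : u * (v * decompose 𝒜 y 0) = 1 := by
    rw [← mul_assoc]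
    exact sub_eq_zero.1 h0
  have := hunit u (IsUnit.of_mul_eq_one _ h1)
  rw [hdu, WithBot.coe_inj] at this
  exact hi this

/-- By `hres` each graded piece is at most one-dimensional over `k`, and a power of `f` or of `g`
spans it. So the classes of `f` and `g` generate `Gr`. -/
theorem grIsAffine_of_residue {k : Type*} [Field k] [Algebra k B]
    (h : ∀ a : k, a ≠ 0 → d (algebraMap k B a) = ((0 : ℤ) : WithBot ℤ)) {f g : B}
    (hf : d f = ((1 : ℤ) : WithBot ℤ)) (hg : d g = ((-1 : ℤ) : WithBot ℤ))
    (hres : ∀ (n : ℤ) (x y : B), d x = (n : WithBot ℤ) → d y = (n : WithBot ℤ) →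
      ∃ a : k, d (x - algebraMap k B a * y) < (n : WithBot ℤ)) : d.GrIsAffine h := by
  let ψ : MvPolynomial (Fin 2) k →+* d.Gr :=
    MvPolynomial.eval₂Hom (d.grConst h) ![d.symbol 1 f hf.le, d.symbol (-1) g hg.le]
  have hψ : d.grConst h = ψ.comp (algebraMap k _) := by
    ext1 a
    exact (MvPolynomial.eval₂Hom_C _ _ a).symm
  have hfψ : d.symbol 1 f hf.le ∈ ψ.range := ⟨MvPolynomial.X 0, by simp [ψ]⟩
  have hgψ : d.symbol (-1) g hg.le ∈ ψ.range := ⟨MvPolynomial.X 1, by simp [ψ]⟩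
  have hpow : ∀ (x : B) (i : ℤ), d x = (i : WithBot ℤ) → ∀ n : ℕ,
      d (x ^ n) = ((n * i : ℤ) : WithBot ℤ) := by
    intro x i hx n
    induction n with
    | zero => simpa using h 1 one_ne_zero
    | succ n ih =>
      rw [pow_succ, d.map_mul', ih, hx, ← WithBot.coe_add]
      congr 1
      push_cast
      ring
  have hex : ∀ n : ℤ, ∃ (y : B) (hy : d y = (n : WithBot ℤ)), d.symbol n y hy.le ∈ ψ.range := by
    intro n
    obtain ⟨m, rfl | rfl⟩ := n.eq_nat_or_neg
    · refine ⟨f ^ m, by simpa using hpow f 1 hf m, ?_⟩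
      have := pow_mem hfψ m
      rw [symbol_pow] at this
      convert! this using 1
      exact symbol_congr' (by simp) rfl _ _
    · refine ⟨g ^ m, by simpa using hpow g (-1) hg m, ?_⟩
      have := pow_mem hgψ m
      rw [symbol_pow] at this
      convert! this using 1
      exact symbol_congr' (by simp) rfl _ _
  have hsurj : Function.Surjective ψ := by
    intro u
    change u ∈ ψ.range
    induction u using symbol_induction with
    | h0 => exact zero_mem _
    | hs i x hx =>
      rcases hx.eq_or_lt with heq | hlt
      · obtain ⟨y, hy, hyψ⟩ := hex i
        obtain ⟨a, ha⟩ := hres i x y heq hy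
        have hc : d.symbol 0 (algebraMap k B a) (d.const_le h a) ∈ ψ.range :=
          ⟨MvPolynomial.C a, MvPolynomial.eval₂Hom_C _ _ a⟩
        have := mul_mem hc hyψ
        rw [symbol_mul] at this
        rw [symbol_congr (zero_add i).symm hx _ ha]
        exact this
      · have h0 : d 0 ≤ (i : WithBot ℤ) := by rw [d.map_zero]; exact bot_le
        rw [symbol_congr rfl hx h0 (by rwa [sub_zero]), symbol_zero i h0]
        exact zero_mem _
    | hadd u v hu hv => exact add_mem hu hv
  rw [GrIsAffine, hψ]
  exact (RingHom.finiteType_algebraMap.2 inferInstance).comp_surjective hsurj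

end

end DegreeFunction

/-! ### The ring of leading coefficients -/

section
open LaurentSeries DegreeFunction

variable {K : Type*} [Field K] {B : Type*} [CommRing B] (φ : B →+* K⸨X⸩)
  (hφ : Function.Injective φ)

/-- The coefficient of `(t⁻¹) ^ i`, as a function on the homogeneous component of degree `i`. -/
noncomputable def leadHom (i : ℤ) : (laurentDegree φ hφ).GrPiece i →+ K :=
  QuotientAddGroup.lift _
    { toFun := fun x : (laurentDegree φ hφ).filtLE i => (φ (x : B)).coeff (-i)
      map_zero' := by simp
      map_add' := fun x y => by simp }
    (fun x hx => (laurentDegree_lt_coe_iff.1 hx).coeff_eq)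

theorem leadHom_mk {i : ℤ} {x : B} {c : K} (h : HasLead (φ x) i c) :
    leadHom φ hφ i ((laurentDegree φ hφ).grMk i x h.laurentDegree_le) = c := h.coeff_eq

theorem leadHom_one : leadHom φ hφ 0 GradedMonoid.GOne.one = 1 := by
  refine leadHom_mk φ hφ ?_
  rw [map_one]
  exact HasLead.one

theorem leadHom_mul {i j : ℤ} (u : (laurentDegree φ hφ).GrPiece i)
    (v : (laurentDegree φ hφ).GrPiece j) :
    leadHom φ hφ (i + j) (GradedMonoid.GMul.mul u v) = leadHom φ hφ i u * leadHom φ hφ j v := by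
  obtain ⟨x, hx, rfl⟩ := grMk_surj _ u
  obtain ⟨y, hy, rfl⟩ := grMk_surj _ v
  have hx' := laurentDegree_le_coe_iff.1 hx
  have hy' := laurentDegree_le_coe_iff.1 hy
  rw [leadHom_mk φ hφ hx', leadHom_mk φ hφ hy']
  refine leadHom_mk φ hφ (x := x * y) ?_
  rw [map_mul]
  exact hx'.mul hy'

/-- The ring homomorphism from the associated graded ring to `K`, sending the class of an element
to its leading coefficient. -/
noncomputable def leadRingHom : (laurentDegree φ hφ).Gr →+* K :=
  DirectSum.toSemiring (leadHom φ hφ) (leadHom_one φ hφ) (leadHom_mul φ hφ)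

variable {φ hφ}

theorem leadRingHom_symbol {i : ℤ} {x : B} {c : K} (h : HasLead (φ x) i c) :
    leadRingHom φ hφ ((laurentDegree φ hφ).symbol i x h.laurentDegree_le) = c := by
  rw [leadRingHom, symbol, DirectSum.toSemiring_of, leadHom_mk φ hφ h]

/-- If the leading coefficients generate an infinite algebraic extension, then the associated
graded ring is not finitely generated. -/
theorem not_grIsAffine_laurentDegree {k : Type*} [Field k] [Algebra k B] [Algebra k K]
    [Algebra.IsAlgebraic k K]
    (hk : ∀ c : k, φ (algebraMap k B c) = HahnSeries.C (algebraMap k K c))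
    (h : ∀ c : k, c ≠ 0 → laurentDegree φ hφ (algebraMap k B c) = ((0 : ℤ) : WithBot ℤ))
    {L : ℕ → IntermediateField k K} (hL : Monotone L) {a : ℕ → K}
    (haL : ∀ j, a j ∈ L (j + 1)) (haL' : ∀ j, a j ∉ L j)
    (ha : ∀ j, ∃ x n, HasLead (φ x) n (a j)) : ¬ (laurentDegree φ hφ).GrIsAffine h := by
  intro haff
  let : Algebra k (laurentDegree φ hφ).Gr := ((laurentDegree φ hφ).grConst h).toAlgebra
  obtain ⟨S, hS⟩ : (⊤ : Subalgebra k (laurentDegree φ hφ).Gr).FG := haff.1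
  -- The images of finitely many generators span a finite extension `M`, which contains all leading
  -- coefficients, in particular every `a j`. The intersections `L j ⊓ M` then increase strictly
  -- inside a finite-dimensional space.
  let M : IntermediateField k K := IntermediateField.adjoin k (leadRingHom φ hφ '' S)
  have hM : FiniteDimensional k M := by
    have := (S.finite_toSet.image (leadRingHom φ hφ)).to_subtype
    exact IntermediateField.finiteDimensional_adjoin fun x _ => Algebra.IsIntegral.isIntegral x
  have hmem : ∀ u, leadRingHom φ hφ u ∈ M := by
    intro u
    have hu : u ∈ Algebra.adjoin k (S : Set (laurentDegree φ hφ).Gr) := hS ▸ Algebra.mem_top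
    induction hu using Algebra.adjoin_induction with
    | mem x hx => exact IntermediateField.subset_adjoin _ _ ⟨x, hx, rfl⟩
    | algebraMap c =>
      have hc : HasLead (φ (algebraMap k B c)) 0 (algebraMap k K c) := by
        rw [hk]
        exact HasLead.const _
      have : leadRingHom φ hφ (algebraMap k _ c) = algebraMap k K c := leadRingHom_symbol hc
      rw [this]
      exact M.algebraMap_mem c
    | add x y _ _ hx hy => rw [map_add]; exact add_mem hx hy
    | mul x y _ _ hx hy => rw [map_mul]; exact mul_mem hx hy
  have haM : ∀ j, a j ∈ M := by
    intro j
    obtain ⟨x, n, hx⟩ := ha j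
    rw [← leadRingHom_symbol (hφ := hφ) hx]
    exact hmem _
  let V : ℕ → Submodule k K := fun j => Subalgebra.toSubmodule (L j ⊓ M).toSubalgebra
  have hVM : ∀ j, V j ≤ Subalgebra.toSubmodule M.toSubalgebra := fun j x hx => hx.2
  have hfinM : FiniteDimensional k (Subalgebra.toSubmodule M.toSubalgebra) := hM
  have hfin : ∀ j, FiniteDimensional k (V j) := fun j =>
    Submodule.finiteDimensional_of_le (hVM j)
  have hlt : StrictMono fun j => Module.finrank k (V j) := by
    refine strictMono_nat_of_lt_succ fun j => ?_
    have := hfin (j + 1)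
    refine Submodule.finrank_lt_finrank_of_lt (lt_of_le_of_ne (fun x hx => ?_) fun heq => ?_)
    · exact ⟨hL j.le_succ hx.1, hx.2⟩
    · have h1 : a j ∈ V (j + 1) := ⟨haL j, haM j⟩
      rw [← heq] at h1
      exact haL' j h1.1
  have h1 := hlt.le_apply (x := Module.finrank k (Subalgebra.toSubmodule M.toSubalgebra) + 1)
  have h2 := Submodule.finrank_mono (hVM (Module.finrank k (Subalgebra.toSubmodule M.toSubalgebra) + 1))
  exact absurd (h1.trans h2) (by simp)

end

/-! ### Degrees of the derivation with respect to `Y` -/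

section
open LaurentSeries MvPolynomial DegreeFunction

variable {k K : Type*} [Field k] [Field K] [CharZero K] [Algebra k K] {y : K⸨X⸩}
  {hy : Function.Injective (seriesHom k y)} {b : ℕ → k} {a : ℕ → K}

/-- As `X` is constant for `∂/∂Y`, the derivative of `keyPoly b (j + 1)` is `2 * keyPoly b j` times
that of `keyPoly b j`; each step adds 3 to the degree, whereas the key polynomials themselves stay
in degree 3. -/
theorem hasLead_pderiv_keyPoly (ha : ∀ j, a j ≠ 0)
    (hkey : ∀ j, HasLead (seriesHom k y (keyPoly b j)) 3 (a j)) (j : ℕ) :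
    ∃ c, c ≠ 0 ∧ HasLead (seriesHom k y (pderiv 1 (keyPoly b j))) (3 * j) c := by
  induction j with
  | zero =>
    refine ⟨1, one_ne_zero, ?_⟩
    rw [keyPoly, pderiv_X_self, map_one]
    exact HasLead.one
  | succ j ih =>
    obtain ⟨c, hc, h⟩ := ih
    have he : pderiv 1 (keyPoly b (j + 1)) = C 2 * (keyPoly b j * pderiv 1 (keyPoly b j)) := by
      rw [keyPoly, map_sub, pderiv_C_mul, pderiv_pow, pderiv_pow, pderiv_X_of_ne (by decide)]
      rw [map_ofNat C]
      simp [mul_assoc]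
    refine ⟨2 * (a j * c), mul_ne_zero two_ne_zero (mul_ne_zero (ha j) hc), ?_⟩
    have h2 := (HasLead.const (2 : K)).mul ((hkey j).mul h)
    rw [he, map_mul, map_mul, seriesHom_C, map_ofNat]
    convert! h2 using 1
    push_cast
    ring

theorem not_derivationDegreeDefined_laurentDegree (ha : ∀ j, a j ≠ 0)
    (hkey : ∀ j, HasLead (seriesHom k y (keyPoly b j)) 3 (a j)) :
    ¬ (laurentDegree (seriesHom k y) hy).DerivationDegreeDefined (pderiv (1 : Fin 2)) := by
  rintro ⟨u, _, hu⟩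
  have hle : ∀ j : ℕ, ((3 * j - 3 : ℤ) : WithBot ℤ) ≤ u := fun j => by
    obtain ⟨c, hc, h⟩ := hasLead_pderiv_keyPoly ha hkey j
    refine hu ⟨keyPoly b j, 3, (hkey j).laurentDegree_eq (ha j), ?_⟩
    rw [h.laurentDegree_eq hc, ← WithBot.coe_add]
    rfl
  cases u with
  | bot => exact absurd (hle 0) (by simp)
  | coe n =>
    have := WithBot.coe_le_coe.1 (hle (n.toNat + 2))
    push_cast at this
    omega

end

/-! ### The `(2,3)`-grading -/

section
open LaurentSeries MvPolynomial DegreeFunction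

variable {k K : Type*} [Field k] [Field K] [Algebra k K] {y : K⸨X⸩} {a : K}

theorem weight23 (m : Fin 2 →₀ ℕ) :
    Finsupp.weight ![(2 : ℤ), 3] m = 2 * (m 0 : ℤ) + 3 * (m 1 : ℤ) := by
  rw [Finsupp.weight_apply, Finsupp.sum_fintype _ _ (by simp)]
  simp [Fin.sum_univ_two, mul_comm]

theorem HasLead.seriesHom_monomial (hy : HasLead y 3 a) (m : Fin 2 →₀ ℕ) (c : k) :
    HasLead (seriesHom k y (monomial m c)) (Finsupp.weight ![(2 : ℤ), 3] m)
      (algebraMap k K c * a ^ m 1) := by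
  have h := ((HasLead.const (algebraMap k K c)).mul
    ((hasLead_X_zero (k := k) (y := y)).pow (m 0))).mul (hy.pow (m 1))
  rw [monomial_eq, Finsupp.prod_fintype _ _ (by simp), Fin.prod_univ_two, map_mul, map_mul,
    map_pow, map_pow, seriesHom_C, seriesHom_X_one, weight23, ← mul_assoc]
  convert! h using 1
  · ring
  · simp

theorem HasLead.sum {ι : Type*} (s : Finset ι) {f : ι → K⸨X⸩} {n : ℤ} {c : ι → K}
    (h : ∀ i ∈ s, HasLead (f i) n (c i)) : HasLead (∑ i ∈ s, f i) n (∑ i ∈ s, c i) := by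
  classical
  induction s using Finset.induction_on with
  | empty => simpa using HasLead.zero n
  | insert i s hi ih =>
    rw [Finset.sum_insert hi, Finset.sum_insert hi]
    exact (h i (Finset.mem_insert_self i s)).add
      (ih fun j hj => h j (Finset.mem_insert_of_mem hj))

/-- If `a` is transcendental over `k`, then the degree of a homogeneous polynomial for the
`(2,3)`-grading is the degree of its value at `(t⁻², a t⁻³ + ⋯)`. -/
theorem hasLead_of_mem_grading23 (ha : Transcendental k a) (hy : HasLead y 3 a) {n : ℤ}
    {f : MvPolynomial (Fin 2) k} (hf : f ∈ grading23 k n) (h0 : f ≠ 0) :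
    ∃ c, c ≠ 0 ∧ HasLead (seriesHom k y f) n c := by
  have hw : ∀ m ∈ f.support, 2 * (m 0 : ℤ) + 3 * (m 1 : ℤ) = n := fun m hm => by
    rw [← weight23]
    exact hf (mem_support_iff.1 hm)
  -- The coefficient of `f` at `t⁻ⁿ` is `p(a)`. In a fixed weight the exponent of `Y` determines
  -- that of `X`, so distinct monomials of `f` stay distinct in `p`, and `p ≠ 0`.
  let p : Polynomial k := ∑ m ∈ f.support, Polynomial.monomial (m 1) (f.coeff m)
  refine ⟨Polynomial.aeval a p, fun hp => ?_, ?_⟩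
  · obtain ⟨m, hm⟩ := Finset.nonempty_iff_ne_empty.2 (support_eq_empty.not.2 h0)
    have hp0 : p = 0 := by
      by_contra hne
      exact ha ⟨p, hne, hp⟩
    have hcoeff := congrArg (fun q => Polynomial.coeff q (m 1)) hp0
    simp only [p, Polynomial.finsetSum_coeff, Polynomial.coeff_monomial, Polynomial.coeff_zero]
      at hcoeff
    rw [Finset.sum_eq_single m (fun m' hm' hne => if_neg fun h1 => hne ?_)
      (fun h => absurd hm h), if_pos rfl] at hcoeff
    · exact mem_support_iff.1 hm hcoeff
    · have h2 := hw m hm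
      have h3 := hw m' hm'
      ext i
      fin_cases i
      · change m' 0 = m 0
        omega
      · exact h1
  · have h : HasLead (∑ m ∈ f.support, seriesHom k y (monomial m (f.coeff m))) n
        (∑ m ∈ f.support, algebraMap k K (f.coeff m) * a ^ m 1) :=
      HasLead.sum _ fun m hm => by
        have := hy.seriesHom_monomial m (f.coeff m)
        rwa [weight23, hw m hm] at this
    rw [← map_sum, support_sum_monomial_coeff] at h
    convert! h using 1
    simp [p, Polynomial.aeval_monomial]

theorem pderiv_one_mem_grading23 {n : ℤ} {f : MvPolynomial (Fin 2) k} (hf : f ∈ grading23 k n) :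
    pderiv 1 f ∈ grading23 k (n - 3) := by
  intro m hm
  rw [coeff_pderiv] at hm
  have := hf (left_ne_zero_of_mul hm)
  rw [weight23] at this ⊢
  simp at this
  omega

/-- The derivation lowers weights by 3, which bounds the jump by `-3`; the bound is attained at `Y`.
-/
theorem derivationDegreeDefined_of_isDeterminedBy_grading23
    {d : DegreeFunction (MvPolynomial (Fin 2) k) ℤ} (hd : d.IsDeterminedBy (grading23 k)) :
    d.DerivationDegreeDefined (pderiv (1 : Fin 2)) := by
  classical
  refine ⟨((-3 : ℤ) : WithBot ℤ), ⟨X 1, 3, ?_, ?_⟩, ?_⟩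
  · exact hd.eq_of_mem (isWeightedHomogeneous_X k ![(2 : ℤ), 3] 1) (X_ne_zero 1)
  · rw [pderiv_X_self, hd.eq_of_mem (i := 0) (isWeightedHomogeneous_one k ![(2 : ℤ), 3]) one_ne_zero]
    rfl
  · rintro _ ⟨f, n, hf, rfl⟩
    have h : d (pderiv 1 f) ≤ ((n - 3 : ℤ) : WithBot ℤ) := by
      rw [← DirectSum.sum_support_decompose (grading23 k) f, map_sum]
      refine d.map_sum_le _ _ fun i hi => ?_
      have hin : i ≤ n := by
        refine WithBot.coe_le_coe.1 (le_of_le_of_eq (Finset.le_max hi) ?_)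
        rw [← hf, hd f]
        congr!
      refine (hd.le_of_mem (pderiv_one_mem_grading23 (SetLike.coe_mem _))).trans ?_
      exact WithBot.coe_le_coe.2 (by omega)
    refine (add_le_add_left h _).trans ?_
    rw [← WithBot.coe_add]
    exact WithBot.coe_le_coe.2 (by omega)

end

/-! ### Constants, residues and elements of negative degree -/

section
open LaurentSeries MvPolynomial DegreeFunction

variable {k K : Type*} [Field k] [Field K] [Algebra k K] {y : K⸨X⸩}

theorem laurentDegree_algebraMap (hy : Function.Injective (seriesHom k y)) (c : k) (hc : c ≠ 0) :
    laurentDegree (seriesHom k y) hy (algebraMap k _ c) = ((0 : ℤ) : WithBot ℤ) := by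
  have h : HasLead (seriesHom k y (algebraMap k _ c)) 0 (algebraMap k K c) := by
    rw [algebraMap_eq, seriesHom_C]
    exact HasLead.const _
  exact h.laurentDegree_eq (by simpa using hc)

theorem laurentDegree_isUnit (hy : Function.Injective (seriesHom k y))
    (x : MvPolynomial (Fin 2) k) (hx : IsUnit x) :
    laurentDegree (seriesHom k y) hy x = ((0 : ℤ) : WithBot ℤ) := by
  obtain ⟨c, hc, rfl⟩ := isUnit_iff_eq_C_of_isReduced.1 hx
  exact laurentDegree_algebraMap hy c hc.ne_zero

/-- Over the coefficient field itself, elements of equal degree are proportional up to terms of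
smaller degree. -/
theorem exists_laurentDegree_sub_lt {y : K⸨X⸩} (hy : Function.Injective (seriesHom K y)) (n : ℤ)
    (f g : MvPolynomial (Fin 2) K)
    (hf : laurentDegree (seriesHom K y) hy f = (n : WithBot ℤ))
    (hg : laurentDegree (seriesHom K y) hy g = (n : WithBot ℤ)) :
    ∃ c : K, laurentDegree (seriesHom K y) hy (f - algebraMap K _ c * g) < (n : WithBot ℤ) := by
  obtain ⟨c, hc, h⟩ := laurentDegree_eq_coe_iff.1 hf
  obtain ⟨d, hd, h'⟩ := laurentDegree_eq_coe_iff.1 hg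
  refine ⟨c / d, laurentDegree_lt_coe_iff.2 ?_⟩
  have h2 := (HasLead.const (c / d)).mul h'
  rw [zero_add, div_mul_cancel₀ c hd] at h2
  have h3 := h.sub h2
  rw [sub_self] at h3
  rw [map_sub, map_mul, algebraMap_eq, seriesHom_C]
  exact h3

/-- If there are elements of negative degree, then every integer is a degree. -/
theorem exists_laurentDegree_eq_of_neg (hy : Function.Injective (seriesHom k y))
    {c : K} (hc : c ≠ 0) (hlead : HasLead y 3 c) {f : MvPolynomial (Fin 2) k} (hf : f ≠ 0)
    (hneg : HasLead (seriesHom k y f) 0 0) :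
    ∃ g h, laurentDegree (seriesHom k y) hy g = ((1 : ℤ) : WithBot ℤ) ∧
      laurentDegree (seriesHom k y) hy h = ((-1 : ℤ) : WithBot ℤ) := by
  obtain ⟨n, d, hd, hl⟩ := HasLead.exists_of_ne_zero ((map_ne_zero_iff _ hy).2 hf)
  obtain ⟨m, rfl⟩ : ∃ m : ℕ, n = -(m + 1 : ℤ) := by
    have hn : n < 0 := by
      by_contra! hn
      rcases hn.eq_or_lt with rfl | hlt
      · exact hd (hl.unique hneg)
      · exact hd (hl.unique (hneg.mono hlt))
    exact ⟨(-n - 1).toNat, by omega⟩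
  have hX := hasLead_X_zero (k := k) (y := y)
  have hY : HasLead (seriesHom k y (X 1)) 3 c := by rwa [seriesHom_X_one]
  -- With `f` of degree `-(m + 1)`, the degrees are `-2(m + 1) + 3 + 2m = 1` and `-4(m + 1) + 3 + 4m
  -- = -1`.
  refine ⟨f ^ 2 * X 1 * X 0 ^ m, f ^ 4 * X 1 * X 0 ^ (2 * m), ?_, ?_⟩
  · refine HasLead.laurentDegree_eq (c := d ^ 2 * c * 1 ^ m) ?_ (by simp [hc, hd])
    have := ((hl.pow 2).mul hY).mul (hX.pow m)
    rw [map_mul, map_mul, map_pow, map_pow]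
    convert! this using 1
    push_cast
    ring
  · refine HasLead.laurentDegree_eq (c := d ^ 4 * c * 1 ^ (2 * m)) ?_ (by simp [hc, hd])
    have := ((hl.pow 4).mul hY).mul (hX.pow (2 * m))
    rw [map_mul, map_mul, map_pow, map_pow]
    convert! this using 1
    push_cast
    ring

end

/-! ### Assembling the three degree functions -/

open LaurentSeries MvPolynomial DegreeFunction in
theorem mainTheorem3 (k₀ k₁ k₂ : Type*) [Field k₀] [Field k₁] [Field k₂]
    [CharZero k₀] [Uncountable k₀]
    [Algebra k₀ k₁] [Algebra k₁ k₂] [Algebra k₀ k₂] [IsScalarTower k₀ k₁ k₂]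
    (hk₁ : IsFunctionFieldOver k₀ k₁) [IsAlgClosure k₁ k₂] :
    ∃ (deg₀ : DegreeFunction (MvPolynomial (Fin 2) k₀) ℤ)
      (deg₁ : DegreeFunction (MvPolynomial (Fin 2) k₁) ℤ)
      (deg₂ : DegreeFunction (MvPolynomial (Fin 2) k₂) ℤ)
      -- (b): the degree of every nonzero constant is zero
      (h₀ : ∀ a : k₀, a ≠ 0 → deg₀ (algebraMap k₀ (MvPolynomial (Fin 2) k₀) a) = ((0 : ℤ) : WithBot ℤ))
      (h₁ : ∀ a : k₁, a ≠ 0 → deg₁ (algebraMap k₁ (MvPolynomial (Fin 2) k₁) a) = ((0 : ℤ) : WithBot ℤ))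
      (h₂ : ∀ a : k₂, a ≠ 0 → deg₂ (algebraMap k₂ (MvPolynomial (Fin 2) k₂) a) = ((0 : ℤ) : WithBot ℤ)),
      -- the first two degree functions take values in `ℕ ∪ {-∞}`
      (∀ f, f ≠ 0 → ∃ n : ℕ, deg₀ f = ((n : ℤ) : WithBot ℤ)) ∧
      (∀ f, f ≠ 0 → ∃ n : ℕ, deg₁ f = ((n : ℤ) : WithBot ℤ)) ∧
      -- (a): each one is the restriction of the following ones
      (∀ f, deg₀ f = deg₁ (MvPolynomial.map (algebraMap k₀ k₁) f)) ∧
      (∀ f, deg₁ f = deg₂ (MvPolynomial.map (algebraMap k₁ k₂) f)) ∧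
      (∀ f, deg₀ f = deg₂ (MvPolynomial.map (algebraMap k₀ k₂) f)) ∧
      -- (c): gradings
      deg₀.IsDeterminedBy (grading23 k₀) ∧
      ¬ deg₁.IsDeterminedByGrading ∧
      ¬ deg₂.IsDeterminedByGrading ∧
      -- (d): finite generation of the associated graded rings
      deg₀.GrIsAffine h₀ ∧ ¬ deg₁.GrIsAffine h₁ ∧ deg₂.GrIsAffine h₂ ∧
      -- (e): the degree of the derivation with respect to `Y`
      deg₀.DerivationDegreeDefined (MvPolynomial.pderiv (1 : Fin 2)) ∧
      ¬ deg₁.DerivationDegreeDefined (MvPolynomial.pderiv (1 : Fin 2)) ∧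
      ¬ deg₂.DerivationDegreeDefined (MvPolynomial.pderiv (1 : Fin 2)) := by
  obtain ⟨b, a, L, hab, htr, hL, haL, haL'⟩ := hk₁.exists_tower k₂
  have : CharZero k₁ := charZero_of_injective_algebraMap (algebraMap k₀ k₁).injective
  have : CharZero k₂ := charZero_of_injective_algebraMap (algebraMap k₀ k₂).injective
  have halg : Algebra.IsAlgebraic k₁ k₂ := IsAlgClosure.isAlgebraic
  have ha : ∀ j, a j ≠ 0 := fun j h => haL' j (h ▸ zero_mem _)
  obtain ⟨y, e, hye, hys⟩ := exists_nested_sqrt_laurent a ha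
  have hlead : ∀ j, HasLead (y j) 3 (a j) := fun j => by
    have := ((hye j).mono (m := 3) (by norm_num)).add (HasLead.single 3 (a j))
    rwa [sub_add_cancel, zero_add] at this
  have hkey₁ : ∀ j, HasLead (seriesHom k₁ (y 0) (keyPoly b j)) 3 (a j) := fun j => by
    rw [seriesHom_keyPoly hab hys]
    exact hlead j
  -- Over `k₂` the same key polynomials are written with `b j` replaced by its image `a j ^ 2`.
  have hφ₂ : ∀ j, seriesHom k₂ (y 0) (keyPoly (fun j => a j ^ 2) j) = y j :=
    seriesHom_keyPoly (fun j => rfl) hys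
  have hkey₂ : ∀ j, HasLead (seriesHom k₂ (y 0) (keyPoly (fun j => a j ^ 2) j)) 3 (a j) :=
    fun j => by
      rw [hφ₂]
      exact hlead j
  have hex : ∀ f : MvPolynomial (Fin 2) k₁, f ≠ 0 → ∃ (n : ℕ) (c : k₂), c ≠ 0 ∧
      HasLead (seriesHom k₁ (y 0) f) n c := fun f hf => by
    obtain ⟨j, hj⟩ := exists_mem_keySpan b f
    obtain ⟨n, c, _, hc, h⟩ := exists_hasLead_of_mem_keySpan hL haL haL' hkey₁ j hj hf
    exact ⟨n, c, hc, h⟩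
  have hinj₁ : Function.Injective (seriesHom k₁ (y 0)) := by
    rw [injective_iff_map_eq_zero]
    intro f hf
    by_contra h0
    obtain ⟨n, c, hc, h⟩ := hex f h0
    exact h.ne_zero hc hf
  have hinj₂ : Function.Injective (seriesHom k₂ (y 0)) :=
    seriesHom_injective_of_isAlgebraic (k := k₁) hinj₁
  have hinj₀ : Function.Injective (seriesHom k₀ (y 0)) := by
    intro f g hfg
    rw [← seriesHom_map (k := k₀) (k' := k₁), ← seriesHom_map (k := k₀) (k' := k₁)] at hfg
    exact map_injective _ (algebraMap k₀ k₁).injective (hinj₁ hfg)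
  -- In `a₁ y₀ - a₀ y₁` the terms in `t⁻³` cancel, leaving the constant `a₁ e₀ - a₀ e₁` plus
  -- positive powers of `t`. Subtracting the constant gives negative degree.
  obtain ⟨H, hH, hHlead⟩ : ∃ H : MvPolynomial (Fin 2) k₂, H ≠ 0 ∧
      HasLead (seriesHom k₂ (y 0) H) 0 0 := by
    refine ⟨C (a 1) * X 1 - C (a 0) * keyPoly (fun j => a j ^ 2) 1 - C (a 1 * e 0 - a 0 * e 1),
      fun h0 => ?_, ?_⟩
    -- The second derivative in `Y` is the nonzero constant `-2 a₀`.
    · have h1 := congrArg (fun f => pderiv 1 (pderiv 1 f)) h0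
      simp only [keyPoly, map_sub, pderiv_C_mul, pderiv_pow, pderiv_X_self, pderiv_C, _root_.map_zero,
        pderiv_X_of_ne (show (0 : Fin 2) ≠ 1 by decide), mul_zero, mul_one, sub_zero, zero_sub,
        Nat.cast_ofNat, pow_one, Nat.add_one_sub_one] at h1
      rw [← map_ofNat C, pderiv_C_mul, pderiv_X_self, neg_eq_zero, mul_one, ← C_mul,
        C_eq_zero] at h1
      exact mul_ne_zero (ha 0) two_ne_zero h1
    · have hs : HahnSeries.C (a 1) * HahnSeries.single (-3) (a 0) =
          HahnSeries.C (a 0) * HahnSeries.single (-3) (a 1) := by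
        rw [HahnSeries.C_apply, HahnSeries.C_apply, HahnSeries.single_mul_single,
          HahnSeries.single_mul_single, mul_comm]
      have h := (((HasLead.const (a 1)).mul (hye 0)).sub ((HasLead.const (a 0)).mul (hye 1))).sub
        (HasLead.const (a 1 * e 0 - a 0 * e 1))
      rw [sub_self, add_zero] at h
      rw [map_sub, map_sub, map_mul, map_mul, hφ₂, seriesHom_C, seriesHom_C, seriesHom_C,
        seriesHom_X_one]
      convert! h using 1
      simp only [Algebra.algebraMap_self, RingHom.id_apply]
      linear_combination hs
  obtain ⟨f₁, f₂, hf₁, hf₂⟩ := exists_laurentDegree_eq_of_neg hinj₂ (ha 0) (hlead 0) hH hHlead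
  have h₀ := laurentDegree_algebraMap hinj₀
  have h₁ := laurentDegree_algebraMap hinj₁
  have h₂ := laurentDegree_algebraMap hinj₂
  have hnat₁ : ∀ f, f ≠ 0 →
      ∃ n : ℕ, laurentDegree (seriesHom k₁ (y 0)) hinj₁ f = ((n : ℤ) : WithBot ℤ) := fun f hf => by
    obtain ⟨n, c, hc, h⟩ := hex f hf
    exact ⟨n, h.laurentDegree_eq hc⟩
  have h01 : ∀ f, laurentDegree (seriesHom k₀ (y 0)) hinj₀ f =
      laurentDegree (seriesHom k₁ (y 0)) hinj₁ (map (algebraMap k₀ k₁) f) :=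
    fun f => laurentDegree_congr (seriesHom_map f).symm
  have hdet : (laurentDegree (seriesHom k₀ (y 0)) hinj₀).IsDeterminedBy (grading23 k₀) :=
    isDeterminedBy_of_forall_mem fun n f hf hf0 => by
      obtain ⟨c, hc, h⟩ := hasLead_of_mem_grading23 (htr 0) (hlead 0) hf hf0
      exact h.laurentDegree_eq hc
  have haff₁ : ¬ (laurentDegree (seriesHom k₁ (y 0)) hinj₁).GrIsAffine h₁ :=
    not_grIsAffine_laurentDegree (fun c => seriesHom_C c) h₁ hL haL haL'
      fun j => ⟨_, _, hkey₁ j⟩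
  refine ⟨laurentDegree _ hinj₀, laurentDegree _ hinj₁, laurentDegree _ hinj₂, h₀, h₁, h₂,
    fun f hf => ?_, hnat₁, h01, fun f => laurentDegree_congr (seriesHom_map f).symm,
    fun f => laurentDegree_congr (seriesHom_map f).symm, hdet,
    fun hd => haff₁ (hd.grIsAffine h₁ hnat₁), ?_,
    hdet.grIsAffine h₀ (isWeightedHomogeneous_C ![(2 : ℤ), 3]), haff₁,
    grIsAffine_of_residue h₂ hf₁ hf₂ (exists_laurentDegree_sub_lt hinj₂),
    derivationDegreeDefined_of_isDeterminedBy_grading23 hdet,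
    not_derivationDegreeDefined_laurentDegree ha hkey₁,
    not_derivationDegreeDefined_laurentDegree ha hkey₂⟩
  · rw [h01]
    exact hnat₁ _ ((map_ne_zero_iff _ (map_injective _ (algebraMap k₀ k₁).injective)).2 hf)
  · refine not_isDeterminedByGrading one_ne_zero hf₁ hf₂ (fun x hx => ?_)
      (laurentDegree_isUnit hinj₂)
    obtain ⟨c, hc, h⟩ := laurentDegree_eq_coe_iff.1 hx
    -- The leading coefficient of a polynomial of degree 0 lies in `k₂` itself, so a constant
    -- inverts it modulo negative degree.
    refine ⟨C c⁻¹, laurentDegree_lt_coe_iff.2 ?_⟩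
    have h3 := (h.mul (HasLead.const c⁻¹)).sub HasLead.one
    rw [mul_inv_cancel₀ hc, sub_self, add_zero] at h3
    rw [map_sub, map_mul, map_one, seriesHom_C]
    exact h3
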